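/- Let $\Omega\subset\mathbb{R}^2$ be a simply connected polygon, i.e. the bounded domain enclosed by a simple closed polygonal curve, and let $\mathcal{T}$ be a finite partition of $\Omega$ into nondegenerate triangles such that the nonempty intersection of any two distinct (closed) elements is either a single common vertex or a single common edge of both. A \emph{noncorner vertex} is an element vertex that is not a vertex of the polygon $\Omega$. Let $\mathcal{V}_K$ denote the set of vertices of $K\in\mathcal{T}$, let $k\ge 1$ be an integer, let $\mathcal{P}_m(K)$ be the polynomials of total degree at most $m$ on $K$, and let $L^2_0(\Omega)=\{q\in L^2(\Omega):\int_\Omega q\,dx=0\}$. A piecewise polynomial is called $C^m$ at a vertex if its polynomial pieces on the elements containing that vertex have the same partial derivatives of order at most $m$ there. Write $(\cdot,\cdot)$ for the $L^2(\Omega)$ inner product, $a(\mathbf{u},\mathbf{v})=(\nabla\mathbf{u},\nabla\mathbf{v})$, and $\mathbf{curl}\,\phi=(\partial_y\phi,-\partial_x\phi)$. Define the global spaces \begin{align*} \Sigma_0&=\{\phi\in H^2_0(\Omega):\phi|_K\in\mathcal{P}_{k+1}(K)\ \forall K\in\mathcal{T},\ \phi\text{ is }C^2\text{ at noncorner vertices}\},\\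 V_0&=\{v\in H^1_0(\Omega):v|_K\in\mathcal{P}_{k}(K)\ \forall K\in\mathcal{T},\ v\text{ is }C^1\text{ at noncorner vertices}\},\qquad \mathbf{V}_0=V_0\times V_0,\\ Q_0&=\{q\in L^2_0(\Omega):q|_K\in\mathcal{P}_{k-1}(K)\ \forall K\in\mathcal{T},\ q\text{ is }C^0\text{ at noncorner vertices}\}, \end{align*} the interior spaces \begin{align*} \Sigma_I&=\{\phi\in\Sigma_0:\phi|_{\partial K}=\partial_n\phi|_{\partial K}=0\ \forall K\in\mathcal{T}\},\\ \mathbf{V}_I&=\{\mathbf{v}\in\mathbf{V}_0:\mathbf{v}|_{\partial K}=\mathbf{0}\ \forall K\in\mathcal{T}\},\\ Q_I&=\Big\{q\in Q_0:\int_K q\,dx=0,\ q|_K(\mathbf{a})=0\ \forall\mathbf{a}\in\mathcal{V}_K,\ \forall K\in\mathcal{T}\Big\}, \end{align*} where the values and normal derivatives on $\partial K$ are those of the polynomial piece on $K$, and the exterior spaces \begin{align*} \tilde\Sigma_E&=\{\phi\in\Sigma_0:a(\mathbf{curl}\,\phi,\mathbf{curl}\,\psi)=0\ \forall\psi\in\Sigma_I\},\\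 \tilde{Q}_E&=\{q\in Q_0:(q,r)=0\ \forall r\in Q_I\},\\ \tilde{\mathbf{V}}_E&=\{\mathbf{v}\in\mathbf{V}_0:\operatorname{div}\mathbf{v}\in\tilde{Q}_E,\ a(\mathbf{v},\mathbf{curl}\,\psi)=0\ \forall\psi\in\Sigma_I\}. \end{align*} Then the following (internal) direct sum decompositions hold: $$\Sigma_0=\Sigma_I\oplus\tilde\Sigma_E,\qquad \mathbf{V}_0=\mathbf{V}_I\oplus\tilde{\mathbf{V}}_E,\qquad Q_0=Q_I\oplus\tilde{Q}_E.$$ -/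

import Mathlib

open MeasureTheory TopologicalSpace
open scoped ContDiff

noncomputable section

namespace StokesFE

/-- Points of the Euclidean plane. -/
abbrev Pt := EuclideanSpace ℝ (Fin 2)

/-- The Hilbert space `L²(Ω)` of real functions; `inner ℝ u v` is `∫_Ω u v`. -/
abbrev L2 (Ω : Opens Pt) := Lp ℝ 2 (volume.restrict (Ω : Set Pt))

/-! ### Sobolev spaces -/

/-- Classical partial derivative. -/
def cpartial (i : Fin 2) (φ : Pt → ℝ) (x : Pt) : ℝ :=
  fderiv ℝ φ x (EuclideanSpace.single i 1)

/-- Test functions: `φ ∈ C_c^∞(Ω)`. -/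
structure IsTest (Ω : Opens Pt) (φ : Pt → ℝ) : Prop where
  smooth : ContDiff ℝ ∞ φ
  compact : HasCompactSupport φ
  support : tsupport φ ⊆ Ω

/-- `w` is the weak partial derivative `∂_i v` in `Ω`. -/
def HasWeakPartial (Ω : Opens Pt) (i : Fin 2) (v w : L2 Ω) : Prop :=
  ∀ φ : Pt → ℝ, IsTest Ω φ →
    ∫ x in (Ω : Set Pt), v x * cpartial i φ x = -∫ x in (Ω : Set Pt), w x * φ x

theorem IsTest.add {Ω : Opens Pt} {φ ψ : Pt → ℝ} (hφ : IsTest Ω φ) (hψ : IsTest Ω ψ) :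
    IsTest Ω (φ + ψ) :=
  ⟨hφ.smooth.add hψ.smooth, hφ.compact.add hψ.compact,
    (tsupport_add φ ψ).trans (Set.union_subset hφ.support hψ.support)⟩

theorem IsTest.smul {Ω : Opens Pt} {φ : Pt → ℝ} (c : ℝ) (hφ : IsTest Ω φ) :
    IsTest Ω (c • φ) :=
  ⟨contDiff_const.smul hφ.smooth, hφ.compact.smul_left,
    (tsupport_smul_subset_right (fun _ => c) φ).trans hφ.support⟩

theorem isTest_zero (Ω : Opens Pt) : IsTest Ω 0 :=
  ⟨contDiff_const, HasCompactSupport.zero, by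
    have : tsupport (0 : Pt → ℝ) = ∅ := by simp [tsupport]
    simp [this]⟩

theorem contDiff_cpartial {φ : Pt → ℝ} (i : Fin 2) (hφ : ContDiff ℝ ∞ φ) :
    ContDiff ℝ ∞ (cpartial i φ) :=
  (hφ.fderiv_right (m := ∞) (by simp)).clm_apply contDiff_const

theorem cpartial_add {φ ψ : Pt → ℝ} (i : Fin 2) (hφ : ContDiff ℝ ∞ φ) (hψ : ContDiff ℝ ∞ ψ) :
    cpartial i (φ + ψ) = cpartial i φ + cpartial i ψ := by
  funext x
  have h1 := (hφ.differentiable (by simp)).differentiableAt (x := x)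
  have h2 := (hψ.differentiable (by simp)).differentiableAt (x := x)
  simp [cpartial, fderiv_add h1 h2]

theorem cpartial_smul {φ : Pt → ℝ} (i : Fin 2) (c : ℝ) (hφ : ContDiff ℝ ∞ φ) :
    cpartial i (c • φ) = c • cpartial i φ := by
  funext x
  have h1 := (hφ.differentiable (by simp)).differentiableAt (x := x)
  simp [cpartial, fderiv_const_smul h1 c]

theorem cpartial_zero (i : Fin 2) : cpartial i 0 = 0 := by
  funext x
  simp [cpartial]

theorem hasCompactSupport_cpartial {φ : Pt → ℝ} (i : Fin 2) (hφ : HasCompactSupport φ) :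
    HasCompactSupport (cpartial i φ) :=
  (hφ.fderiv ℝ).comp_left (g := fun L : Pt →L[ℝ] ℝ => L (EuclideanSpace.single i 1)) rfl

theorem integrable_mul (Ω : Opens Pt) (v : L2 Ω) {φ : Pt → ℝ} (h1 : Continuous φ)
    (h2 : HasCompactSupport φ) :
    Integrable (fun x => v x * φ x) (volume.restrict (Ω : Set Pt)) := by
  have := (Lp.memLp v).integrable_mul (h1.memLp_of_hasCompactSupport h2 (p := 2)
    (μ := volume.restrict (Ω : Set Pt)))
  exact this

theorem HasWeakPartial.unique {Ω : Opens Pt} {i : Fin 2} {v w w' : L2 Ω}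
    (h : HasWeakPartial Ω i v w) (h' : HasWeakPartial Ω i v w') : w = w' := by
  have hloc : LocallyIntegrableOn (fun x => w x - w' x) (Ω : Set Pt)
      (volume.restrict (Ω : Set Pt)) := by
    have := (((Lp.memLp w).sub (Lp.memLp w')).locallyIntegrable (by norm_num))
    exact this.locallyIntegrableOn _
  have key := Ω.isOpen.ae_eq_zero_of_integral_contDiff_smul_eq_zero hloc (by
    intro g g1 g2 g3
    have e := (h g ⟨g1, g2, g3⟩).symm.trans (h' g ⟨g1, g2, g3⟩)
    have e2 := neg_injective e
    have i1 := integrable_mul Ω w g1.continuous g2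
    have i2 := integrable_mul Ω w' g1.continuous g2
    calc ∫ x in (Ω : Set Pt), g x • (w x - w' x)
        = ∫ x in (Ω : Set Pt), (w x * g x - w' x * g x) := by
          congr 1; funext x; simp only [smul_eq_mul]; ring
      _ = 0 := by rw [integral_sub i1 i2, e2, sub_self])
  apply Lp.ext
  filter_upwards [key, ae_restrict_mem Ω.isOpen.measurableSet] with x hx hm
  exact sub_eq_zero.mp (hx hm)

theorem HasWeakPartial.add {Ω : Opens Pt} {i : Fin 2} {v w v' w' : L2 Ω}
    (h : HasWeakPartial Ω i v w) (h' : HasWeakPartial Ω i v' w') :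
    HasWeakPartial Ω i (v + v') (w + w') := by
  intro φ hφ
  have c1 := (contDiff_cpartial i hφ.smooth).continuous
  have c2 := hasCompactSupport_cpartial i hφ.compact
  have e1 : ∫ x in (Ω : Set Pt), (v + v') x * cpartial i φ x =
      ∫ x in (Ω : Set Pt), (v x * cpartial i φ x + v' x * cpartial i φ x) := by
    apply integral_congr_ae
    filter_upwards [Lp.coeFn_add v v'] with x hx
    rw [hx, Pi.add_apply, add_mul]
  have e2 : ∫ x in (Ω : Set Pt), (w + w') x * φ x =
      ∫ x in (Ω : Set Pt), (w x * φ x + w' x * φ x) := by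
    apply integral_congr_ae
    filter_upwards [Lp.coeFn_add w w'] with x hx
    rw [hx, Pi.add_apply, add_mul]
  rw [e1, e2, integral_add (integrable_mul Ω v c1 c2) (integrable_mul Ω v' c1 c2),
    integral_add (integrable_mul Ω w hφ.smooth.continuous hφ.compact)
      (integrable_mul Ω w' hφ.smooth.continuous hφ.compact), h φ hφ, h' φ hφ]
  ring

theorem HasWeakPartial.smul {Ω : Opens Pt} {i : Fin 2} {v w : L2 Ω} (c : ℝ)
    (h : HasWeakPartial Ω i v w) : HasWeakPartial Ω i (c • v) (c • w) := by
  intro φ hφ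
  have e1 : ∫ x in (Ω : Set Pt), (c • v) x * cpartial i φ x =
      ∫ x in (Ω : Set Pt), c * (v x * cpartial i φ x) := by
    apply integral_congr_ae
    filter_upwards [Lp.coeFn_smul c v] with x hx
    rw [hx, Pi.smul_apply, smul_eq_mul, mul_assoc]
  have e2 : ∫ x in (Ω : Set Pt), (c • w) x * φ x =
      ∫ x in (Ω : Set Pt), c * (w x * φ x) := by
    apply integral_congr_ae
    filter_upwards [Lp.coeFn_smul c w] with x hx
    rw [hx, Pi.smul_apply, smul_eq_mul, mul_assoc]
  rw [e1, e2, integral_const_mul, integral_const_mul, h φ hφ]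
  ring

theorem hasWeakPartial_zero (Ω : Opens Pt) (i : Fin 2) :
    HasWeakPartial Ω i (0 : L2 Ω) 0 := by
  have h : ∀ f : Pt → ℝ, ∫ x in (Ω : Set Pt), (0 : L2 Ω) x * f x = 0 := by
    intro f
    rw [← integral_zero Pt ℝ (μ := volume.restrict (Ω : Set Pt))]
    apply integral_congr_ae
    filter_upwards [Lp.coeFn_zero ℝ 2 (volume.restrict (Ω : Set Pt))] with x hx
    rw [hx, Pi.zero_apply, zero_mul]
  intro φ _
  rw [h, h, neg_zero]

/-- The Sobolev space `H¹(Ω)`. -/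
def H1 (Ω : Opens Pt) : Submodule ℝ (L2 Ω) where
  carrier := {v | ∀ i, ∃ w, HasWeakPartial Ω i v w}
  add_mem' := fun hu hv i =>
    let ⟨_, h⟩ := hu i
    let ⟨_, h'⟩ := hv i
    ⟨_, h.add h'⟩
  zero_mem' := fun i => ⟨0, hasWeakPartial_zero Ω i⟩
  smul_mem' := fun c _ hu i =>
    let ⟨_, h⟩ := hu i
    ⟨_, h.smul c⟩

open Classical in
/-- The weak partial derivative `∂_i v` (the value `0` where it does not exist). -/
def wpartial {Ω : Opens Pt} (i : Fin 2) (v : L2 Ω) : L2 Ω :=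
  if h : ∃ w, HasWeakPartial Ω i v w then h.choose else 0

theorem HasWeakPartial.wpartial_eq {Ω : Opens Pt} {i : Fin 2} {v w : L2 Ω}
    (h : HasWeakPartial Ω i v w) : wpartial i v = w := by
  have hex : ∃ w, HasWeakPartial Ω i v w := ⟨w, h⟩
  rw [wpartial, dif_pos hex]
  exact hex.choose_spec.unique h

theorem hasWeakPartial_wpartial {Ω : Opens Pt} {v : L2 Ω} (hv : v ∈ H1 Ω) (i : Fin 2) :
    HasWeakPartial Ω i v (wpartial i v) := by
  obtain ⟨w, h⟩ := hv i
  rwa [h.wpartial_eq]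

theorem wpartial_zero {Ω : Opens Pt} (i : Fin 2) : wpartial i (0 : L2 Ω) = 0 :=
  (hasWeakPartial_zero Ω i).wpartial_eq

theorem wpartial_add {Ω : Opens Pt} (i : Fin 2) {u v : L2 Ω} (hu : u ∈ H1 Ω) (hv : v ∈ H1 Ω) :
    wpartial i (u + v) = wpartial i u + wpartial i v :=
  ((hasWeakPartial_wpartial hu i).add (hasWeakPartial_wpartial hv i)).wpartial_eq

theorem wpartial_smul {Ω : Opens Pt} (i : Fin 2) (c : ℝ) {u : L2 Ω} (hu : u ∈ H1 Ω) :
    wpartial i (c • u) = c • wpartial i u :=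
  ((hasWeakPartial_wpartial hu i).smul c).wpartial_eq

/-- The Sobolev space `H²(Ω)`. -/
def H2 (Ω : Opens Pt) : Submodule ℝ (L2 Ω) where
  carrier := {v | v ∈ H1 Ω ∧ ∀ i, wpartial i v ∈ H1 Ω}
  add_mem' := fun hu hv => ⟨add_mem hu.1 hv.1, fun i => by
    rw [wpartial_add i hu.1 hv.1]
    exact add_mem (hu.2 i) (hv.2 i)⟩
  zero_mem' := ⟨zero_mem _, fun i => by
    rw [wpartial_zero]
    exact zero_mem _⟩
  smul_mem' := fun c _ hu => ⟨Submodule.smul_mem _ c hu.1, fun i => by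
    rw [wpartial_smul i c hu.1]
    exact Submodule.smul_mem _ c (hu.2 i)⟩

theorem ae_add {Ω : Opens Pt} {u v : L2 Ω} {f g : Pt → ℝ}
    (hu : u =ᵐ[volume.restrict (Ω : Set Pt)] f) (hv : v =ᵐ[volume.restrict (Ω : Set Pt)] g) :
    (u + v : L2 Ω) =ᵐ[volume.restrict (Ω : Set Pt)] f + g :=
  (Lp.coeFn_add u v).trans (hu.add hv)

theorem ae_smul {Ω : Opens Pt} {u : L2 Ω} {f : Pt → ℝ} (c : ℝ)
    (hu : u =ᵐ[volume.restrict (Ω : Set Pt)] f) :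
    (c • u : L2 Ω) =ᵐ[volume.restrict (Ω : Set Pt)] c • f :=
  (Lp.coeFn_smul c u).trans (hu.const_smul c)

/-- The triples `(φ, ∇φ)` with `φ ∈ C_c^∞(Ω)`, as a subspace of `L²(Ω) × L²(Ω)²`. -/
def testJet1 (Ω : Opens Pt) : Submodule ℝ (L2 Ω × (Fin 2 → L2 Ω)) where
  carrier := {z | ∃ φ : Pt → ℝ, IsTest Ω φ ∧ z.1 =ᵐ[volume.restrict (Ω : Set Pt)] φ ∧
    ∀ i, z.2 i =ᵐ[volume.restrict (Ω : Set Pt)] cpartial i φ}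
  add_mem' := by
    rintro y z ⟨φ, hφ, h0, h1⟩ ⟨ψ, hψ, g0, g1⟩
    refine ⟨φ + ψ, hφ.add hψ, ae_add h0 g0, fun i => ?_⟩
    rw [cpartial_add i hφ.smooth hψ.smooth]
    exact ae_add (h1 i) (g1 i)
  zero_mem' := by
    refine ⟨0, isTest_zero Ω, Lp.coeFn_zero _ _ _, fun i => ?_⟩
    rw [cpartial_zero]
    exact Lp.coeFn_zero _ _ _
  smul_mem' := by
    rintro c z ⟨φ, hφ, h0, h1⟩
    refine ⟨c • φ, hφ.smul c, ae_smul c h0, fun i => ?_⟩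
    rw [cpartial_smul i c hφ.smooth]
    exact ae_smul c (h1 i)

/-- The tuples `(φ, ∇φ, D²φ)` with `φ ∈ C_c^∞(Ω)`. -/
def testJet2 (Ω : Opens Pt) :
    Submodule ℝ (L2 Ω × (Fin 2 → L2 Ω) × (Fin 2 → Fin 2 → L2 Ω)) where
  carrier := {z | ∃ φ : Pt → ℝ, IsTest Ω φ ∧ z.1 =ᵐ[volume.restrict (Ω : Set Pt)] φ ∧
    (∀ i, z.2.1 i =ᵐ[volume.restrict (Ω : Set Pt)] cpartial i φ) ∧
    ∀ i j, z.2.2 i j =ᵐ[volume.restrict (Ω : Set Pt)] cpartial i (cpartial j φ)}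
  add_mem' := by
    rintro y z ⟨φ, hφ, h0, h1, h2⟩ ⟨ψ, hψ, g0, g1, g2⟩
    refine ⟨φ + ψ, hφ.add hψ, ae_add h0 g0, fun i => ?_, fun i j => ?_⟩
    · rw [cpartial_add i hφ.smooth hψ.smooth]
      exact ae_add (h1 i) (g1 i)
    · rw [cpartial_add j hφ.smooth hψ.smooth,
        cpartial_add i (contDiff_cpartial j hφ.smooth) (contDiff_cpartial j hψ.smooth)]
      exact ae_add (h2 i j) (g2 i j)
  zero_mem' := by
    refine ⟨0, isTest_zero Ω, Lp.coeFn_zero _ _ _, fun i => ?_, fun i j => ?_⟩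
    · rw [cpartial_zero]
      exact Lp.coeFn_zero _ _ _
    · rw [cpartial_zero, cpartial_zero]
      exact Lp.coeFn_zero _ _ _
  smul_mem' := by
    rintro c z ⟨φ, hφ, h0, h1, h2⟩
    refine ⟨c • φ, hφ.smul c, ae_smul c h0, fun i => ?_, fun i j => ?_⟩
    · rw [cpartial_smul i c hφ.smooth]
      exact ae_smul c (h1 i)
    · rw [cpartial_smul j c hφ.smooth, cpartial_smul i c (contDiff_cpartial j hφ.smooth)]
      exact ae_smul c (h2 i j)

/-- `H¹₀(Ω)`: the closure of `C_c^∞(Ω)` in `H¹(Ω)`. -/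
def H10 (Ω : Opens Pt) : Submodule ℝ (L2 Ω) where
  carrier := {v | v ∈ H1 Ω ∧
    (v, fun i => wpartial i v) ∈ closure (testJet1 Ω : Set (L2 Ω × (Fin 2 → L2 Ω)))}
  add_mem' := by
    rintro u v ⟨hu, hu'⟩ ⟨hv, hv'⟩
    refine ⟨add_mem hu hv, ?_⟩
    have h := add_mem (S := Submodule ℝ (L2 Ω × (Fin 2 → L2 Ω)))
      (s := (testJet1 Ω).topologicalClosure) hu' hv'
    have e : (u + v, fun i => wpartial i (u + v)) =
        (u, fun i => wpartial i u) + (v, fun i => wpartial i v) := by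
      simp only [wpartial_add _ hu hv]
      rfl
    rw [e]
    exact h
  zero_mem' := by
    refine ⟨zero_mem _, subset_closure ?_⟩
    simp only [wpartial_zero]
    exact zero_mem (testJet1 Ω)
  smul_mem' := by
    rintro c u ⟨hu, hu'⟩
    refine ⟨Submodule.smul_mem _ c hu, ?_⟩
    have h := Submodule.smul_mem (testJet1 Ω).topologicalClosure c hu'
    have e : (c • u, fun i => wpartial i (c • u)) = c • (u, fun i => wpartial i u) := by
      simp only [wpartial_smul _ c hu]
      rfl
    rw [e]
    exact h

/-- `H²₀(Ω)`: the closure of `C_c^∞(Ω)` in `H²(Ω)`. -/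
def H20 (Ω : Opens Pt) : Submodule ℝ (L2 Ω) where
  carrier := {v | v ∈ H2 Ω ∧
    (v, (fun i => wpartial i v), fun i j => wpartial i (wpartial j v)) ∈
      closure (testJet2 Ω : Set (L2 Ω × (Fin 2 → L2 Ω) × (Fin 2 → Fin 2 → L2 Ω)))}
  add_mem' := by
    rintro u v ⟨hu, hu'⟩ ⟨hv, hv'⟩
    refine ⟨add_mem hu hv, ?_⟩
    have h := add_mem (S := Submodule ℝ (L2 Ω × (Fin 2 → L2 Ω) × (Fin 2 → Fin 2 → L2 Ω)))
      (s := (testJet2 Ω).topologicalClosure) hu' hv'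
    have e : (u + v, (fun i => wpartial i (u + v)), fun i j => wpartial i (wpartial j (u + v))) =
        (u, (fun i => wpartial i u), fun i j => wpartial i (wpartial j u)) +
        (v, (fun i => wpartial i v), fun i j => wpartial i (wpartial j v)) := by
      simp only [wpartial_add _ hu.1 hv.1, wpartial_add _ (hu.2 _) (hv.2 _)]
      rfl
    rw [e]
    exact h
  zero_mem' := by
    refine ⟨zero_mem _, subset_closure ?_⟩
    simp only [wpartial_zero]
    exact zero_mem (testJet2 Ω)
  smul_mem' := by
    rintro c u ⟨hu, hu'⟩
    refine ⟨Submodule.smul_mem _ c hu, ?_⟩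
    have h := Submodule.smul_mem (testJet2 Ω).topologicalClosure c hu'
    have e : (c • u, (fun i => wpartial i (c • u)), fun i j => wpartial i (wpartial j (c • u))) =
        c • (u, (fun i => wpartial i u), fun i j => wpartial i (wpartial j u)) := by
      simp only [wpartial_smul _ c hu.1, wpartial_smul _ c (hu.2 _)]
      rfl
    rw [e]
    exact h

/-! ### Differential operators and bilinear forms -/

/-- `curl φ = (∂_y φ, -∂_x φ)`. -/
def curl {Ω : Opens Pt} (φ : L2 Ω) : L2 Ω × L2 Ω := (wpartial 1 φ, -wpartial 0 φ)

/-- `div v = ∂_x v₁ + ∂_y v₂`. -/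
def div {Ω : Opens Pt} (v : L2 Ω × L2 Ω) : L2 Ω := wpartial 0 v.1 + wpartial 1 v.2

/-- `a(u, v) = ∫_Ω ∇u : ∇v`. -/
def a {Ω : Opens Pt} (u v : L2 Ω × L2 Ω) : ℝ :=
  ∑ j, (inner ℝ (wpartial j u.1) (wpartial j v.1) + inner ℝ (wpartial j u.2) (wpartial j v.2))

theorem a_add_left {Ω : Opens Pt} {u v w : L2 Ω × L2 Ω} (hu : u ∈ (H1 Ω).prod (H1 Ω))
    (hv : v ∈ (H1 Ω).prod (H1 Ω)) : a (u + v) w = a u w + a v w := by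
  simp only [a, Prod.fst_add, Prod.snd_add, wpartial_add _ hu.1 hv.1, wpartial_add _ hu.2 hv.2,
    inner_add_left, ← Finset.sum_add_distrib]
  exact Finset.sum_congr rfl fun _ _ => by ring

theorem a_smul_left {Ω : Opens Pt} {u w : L2 Ω × L2 Ω} (c : ℝ) (hu : u ∈ (H1 Ω).prod (H1 Ω)) :
    a (c • u) w = c * a u w := by
  simp only [a, Prod.smul_fst, Prod.smul_snd, wpartial_smul _ c hu.1, wpartial_smul _ c hu.2,
    real_inner_smul_left, Finset.mul_sum, mul_add]

theorem a_zero_left {Ω : Opens Pt} (w : L2 Ω × L2 Ω) : a 0 w = 0 := by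
  simp [a, wpartial_zero]

theorem curl_mem {Ω : Opens Pt} {φ : L2 Ω} (h : φ ∈ H2 Ω) : curl φ ∈ (H1 Ω).prod (H1 Ω) :=
  ⟨h.2 1, neg_mem (h.2 0)⟩

theorem curl_add {Ω : Opens Pt} {φ ψ : L2 Ω} (h : φ ∈ H1 Ω) (h' : ψ ∈ H1 Ω) :
    curl (φ + ψ) = curl φ + curl ψ := by
  simp only [curl, wpartial_add _ h h', Prod.mk_add_mk, neg_add]

theorem curl_smul {Ω : Opens Pt} {φ : L2 Ω} (c : ℝ) (h : φ ∈ H1 Ω) :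
    curl (c • φ) = c • curl φ := by
  simp only [curl, wpartial_smul _ c h, Prod.smul_mk, smul_neg]

theorem curl_zero {Ω : Opens Pt} : curl (0 : L2 Ω) = 0 := by
  simp only [curl, wpartial_zero, neg_zero]
  rfl

theorem div_add {Ω : Opens Pt} {u v : L2 Ω × L2 Ω} (hu : u ∈ (H1 Ω).prod (H1 Ω))
    (hv : v ∈ (H1 Ω).prod (H1 Ω)) : div (u + v) = div u + div v := by
  simp only [div, Prod.fst_add, Prod.snd_add, wpartial_add _ hu.1 hv.1, wpartial_add _ hu.2 hv.2]
  abel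

theorem div_smul {Ω : Opens Pt} {u : L2 Ω × L2 Ω} (c : ℝ) (hu : u ∈ (H1 Ω).prod (H1 Ω)) :
    div (c • u) = c • div u := by
  simp only [div, Prod.smul_fst, Prod.smul_snd, wpartial_smul _ c hu.1, wpartial_smul _ c hu.2,
    smul_add]

theorem div_zero {Ω : Opens Pt} : div (0 : L2 Ω × L2 Ω) = 0 := by
  simp [div, wpartial_zero]

/-! ### Polygons and meshes -/

/-- A (nondegenerate) triangle; the closed element is `K.closedInterior`, the open one
`K.interior`. -/
abbrev Tri := Affine.Triangle ℝ Pt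

/-- `Ω` is the bounded plane domain enclosed by the simple closed polygon `P`, whose vertices
`P 0, …, P (n-1)` are true corners. Such a domain is simply connected. -/
structure IsPolygonalDomain {n : ℕ} [NeZero n] (Ω : Opens Pt) (P : Polygon Pt n) : Prop where
  nondegenerate : P.HasNondegenerateVertices ℝ
  injective : Function.Injective P.vertices
  simple : ∀ i j, i ≠ j → P.edgeSet ℝ i ∩ P.edgeSet ℝ j ⊆
    {P i, P (finRotate n i)} ∩ {P j, P (finRotate n j)}
  connected : IsConnected (Ω : Set Pt)
  bounded : Bornology.IsBounded (Ω : Set Pt)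
  frontier_eq : frontier (Ω : Set Pt) = P.boundary ℝ

/-- `T` is a conforming partition of `Ω` into triangles: two distinct elements are disjoint or
meet in a single common vertex or in a single common edge. -/
structure IsMesh (Ω : Opens Pt) (T : Finset Tri) : Prop where
  interior_subset : ∀ K ∈ T, K.interior ⊆ (Ω : Set Pt)
  cover : ⋃ K ∈ T, K.closedInterior = closure (Ω : Set Pt)
  conforming : ∀ K ∈ T, ∀ K' ∈ T, K ≠ K' →
    K.closedInterior ∩ K'.closedInterior = ∅ ∨
    (∃ x ∈ Set.range K.points ∩ Set.range K'.points,
      K.closedInterior ∩ K'.closedInterior = {x}) ∨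
    (∃ x ∈ Set.range K.points ∩ Set.range K'.points,
      ∃ y ∈ Set.range K.points ∩ Set.range K'.points, x ≠ y ∧
        K.closedInterior ∩ K'.closedInterior = segment ℝ x y)

/-! ### Piecewise polynomials -/

/-- Polynomials in the two coordinates of the plane. -/
abbrev Poly := MvPolynomial (Fin 2) ℝ

/-- Evaluation of a polynomial at a point, linear in the polynomial. -/
def evalAt (x : Pt) : Poly →ₗ[ℝ] ℝ := (MvPolynomial.aeval (fun i => x i)).toLinearMap

/-- The partial derivative `∂_i`. -/
def pd (i : Fin 2) : Module.End ℝ Poly := (MvPolynomial.pderiv i).toLinearMap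

/-- `v|_K = p`. -/
def HasPiece (Ω : Opens Pt) (K : Tri) (v : L2 Ω) (p : Poly) : Prop :=
  ∀ᵐ x ∂(volume.restrict (Ω : Set Pt)), x ∈ K.closedInterior → v x = evalAt x p

theorem HasPiece.add {Ω : Opens Pt} {K : Tri} {u v : L2 Ω} {p q : Poly}
    (h : HasPiece Ω K u p) (h' : HasPiece Ω K v q) : HasPiece Ω K (u + v) (p + q) := by
  filter_upwards [h, h', Lp.coeFn_add u v] with x hx hx' e hm
  rw [e, Pi.add_apply, hx hm, hx' hm, map_add]

theorem HasPiece.smul {Ω : Opens Pt} {K : Tri} {u : L2 Ω} {p : Poly} (c : ℝ)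
    (h : HasPiece Ω K u p) : HasPiece Ω K (c • u) (c • p) := by
  filter_upwards [h, Lp.coeFn_smul c u] with x hx e hm
  rw [e, Pi.smul_apply, hx hm, map_smul]

theorem hasPiece_zero (Ω : Opens Pt) (K : Tri) : HasPiece Ω K 0 0 := by
  filter_upwards [Lp.coeFn_zero ℝ 2 (volume.restrict (Ω : Set Pt))] with x e _
  rw [e, Pi.zero_apply, map_zero]

/-- All partial derivatives of order at most `m` of `p` and `q` agree at `x`. -/
def SameJet (m : ℕ) (x : Pt) (p q : Poly) : Prop :=
  ∀ i j : ℕ, i + j ≤ m → evalAt x ((pd 0 ^ i) ((pd 1 ^ j) p)) = evalAt x ((pd 0 ^ i) ((pd 1 ^ j) q))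

/-- Functions on `Ω` that are polynomials of degree at most `d` on each element and `C^m` at the
noncorner vertices (those element vertices that are not vertices of the polygon `P`): the pieces
on the elements around such a vertex have the same derivatives up to order `m` there. -/
def piecewisePoly {n : ℕ} (Ω : Opens Pt) (P : Polygon Pt n) (T : Finset Tri) (d m : ℕ) :
    Submodule ℝ (L2 Ω) where
  carrier := {v | ∃ p : Tri → Poly,
    (∀ K ∈ T, (p K).totalDegree ≤ d ∧ HasPiece Ω K v (p K)) ∧
    ∀ x, x ∉ Set.range P.vertices → ∀ K ∈ T, ∀ K' ∈ T,
      x ∈ Set.range K.points → x ∈ Set.range K'.points → SameJet m x (p K) (p K')}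
  add_mem' := by
    rintro u v ⟨p, h, h'⟩ ⟨q, g, g'⟩
    refine ⟨p + q, fun K hK => ⟨?_, (h K hK).2.add (g K hK).2⟩, ?_⟩
    · exact (MvPolynomial.totalDegree_add _ _).trans (max_le (h K hK).1 (g K hK).1)
    · intro x hx K hK K' hK' hm hm' i j hij
      simp only [Pi.add_apply, map_add, h' x hx K hK K' hK' hm hm' i j hij,
        g' x hx K hK K' hK' hm hm' i j hij]
  zero_mem' := ⟨0, fun K _ => ⟨by simp, hasPiece_zero Ω K⟩, fun _ _ _ _ _ _ _ _ _ _ _ => rfl⟩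
  smul_mem' := by
    rintro c u ⟨p, h, h'⟩
    refine ⟨c • p, fun K hK => ⟨?_, (h K hK).2.smul c⟩, ?_⟩
    · exact (MvPolynomial.totalDegree_smul_le c (p K)).trans (h K hK).1
    · intro x hx K hK K' hK' hm hm' i j hij
      simp only [Pi.smul_apply, map_smul, h' x hx K hK K' hK' hm hm' i j hij]

/-- `L²₀(Ω)`. -/
def L20 (Ω : Opens Pt) : Submodule ℝ (L2 Ω) where
  carrier := {q | Integrable q (volume.restrict (Ω : Set Pt)) ∧ ∫ x in (Ω : Set Pt), q x = 0}
  add_mem' := by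
    rintro p q ⟨h, h'⟩ ⟨g, g'⟩
    refine ⟨(h.add g).congr (Lp.coeFn_add p q).symm, ?_⟩
    rw [integral_congr_ae (Lp.coeFn_add p q)]
    simp only [Pi.add_apply]
    rw [integral_add h g, h', g', add_zero]
  zero_mem' := by
    refine ⟨(integrable_zero _ _ _).congr (Lp.coeFn_zero ℝ 2 _).symm, ?_⟩
    rw [integral_congr_ae (Lp.coeFn_zero ℝ 2 _)]
    simp
  smul_mem' := by
    rintro c q ⟨h, h'⟩
    refine ⟨(h.smul c).congr (Lp.coeFn_smul c q).symm, ?_⟩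
    rw [integral_congr_ae (Lp.coeFn_smul c q)]
    simp only [Pi.smul_apply]
    rw [integral_smul, h', smul_zero]

/-! ### The global spaces -/

section Spaces

variable {n : ℕ} (Ω : Opens Pt) (P : Polygon Pt n) (T : Finset Tri) (k : ℕ)

/-- `Σ₀`. -/
def Sigma0 : Submodule ℝ (L2 Ω) := H20 Ω ⊓ piecewisePoly Ω P T (k + 1) 2

/-- The scalar space `V`. -/
def V : Submodule ℝ (L2 Ω) := H1 Ω ⊓ piecewisePoly Ω P T k 1

/-- The vector space `𝐕₀ = V₀ × V₀`, with `V₀ = V ∩ H¹₀(Ω)`. -/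
def V0 : Submodule ℝ (L2 Ω × L2 Ω) := (V Ω P T k ⊓ H10 Ω).prod (V Ω P T k ⊓ H10 Ω)

/-- The space `Q`. -/
def Q : Submodule ℝ (L2 Ω) := piecewisePoly Ω P T (k - 1) 0

/-- `Q₀ = Q ∩ L²₀(Ω)`. -/
def Q0 : Submodule ℝ (L2 Ω) := Q Ω P T k ⊓ L20 Ω

/-! ### The interior spaces -/

variable {Ω} in
/-- `v|_{∂K} = 0`, where `∂K` is the union of the three edges of `K`. -/
def ZeroOnBoundary (K : Tri) (v : L2 Ω) : Prop :=
  ∃ p : Poly, HasPiece Ω K v p ∧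
    ∀ i j, i ≠ j → ∀ x ∈ segment ℝ (K.points i) (K.points j), evalAt x p = 0

variable {Ω} in
/-- `∂_n v|_{∂K} = 0`: on each edge, the derivative in each direction normal to it vanishes. -/
def ZeroNormalDerivOnBoundary (K : Tri) (v : L2 Ω) : Prop :=
  ∃ p : Poly, HasPiece Ω K v p ∧
    ∀ i j, i ≠ j → ∀ x ∈ segment ℝ (K.points i) (K.points j),
      ∀ ν : Pt, inner ℝ ν (K.points j - K.points i) = 0 →
        ∑ l, ν l * evalAt x (pd l p) = 0

variable {Ω} in
/-- `q|_K` vanishes at the vertices of `K`. -/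
def ZeroAtVertices (K : Tri) (v : L2 Ω) : Prop :=
  ∃ p : Poly, HasPiece Ω K v p ∧ ∀ i, evalAt (K.points i) p = 0

/-- `Σ_I`. -/
def SigmaI : Submodule ℝ (L2 Ω) where
  carrier := {φ | φ ∈ Sigma0 Ω P T k ∧
    ∀ K ∈ T, ZeroOnBoundary K φ ∧ ZeroNormalDerivOnBoundary K φ}
  add_mem' := by
    rintro u v ⟨hu, hu'⟩ ⟨hv, hv'⟩
    refine ⟨add_mem hu hv, fun K hK => ?_⟩
    obtain ⟨⟨p, h1, h2⟩, p', h3, h4⟩ := hu' K hK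
    obtain ⟨⟨q, g1, g2⟩, q', g3, g4⟩ := hv' K hK
    refine ⟨⟨p + q, h1.add g1, fun i j hij x hx => ?_⟩,
      p' + q', h3.add g3, fun i j hij x hx ν hν => ?_⟩
    · rw [map_add, h2 i j hij x hx, g2 i j hij x hx, add_zero]
    · simp only [map_add, mul_add, Finset.sum_add_distrib]
      rw [h4 i j hij x hx ν hν, g4 i j hij x hx ν hν, add_zero]
  zero_mem' := ⟨zero_mem _, fun K _ => ⟨⟨0, hasPiece_zero Ω K, by simp⟩,
    0, hasPiece_zero Ω K, by simp⟩⟩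
  smul_mem' := by
    rintro c u ⟨hu, hu'⟩
    refine ⟨Submodule.smul_mem _ c hu, fun K hK => ?_⟩
    obtain ⟨⟨p, h1, h2⟩, p', h3, h4⟩ := hu' K hK
    refine ⟨⟨c • p, h1.smul c, fun i j hij x hx => ?_⟩,
      c • p', h3.smul c, fun i j hij x hx ν hν => ?_⟩
    · rw [map_smul, h2 i j hij x hx, smul_zero]
    · have := h4 i j hij x hx ν hν
      simp only [map_smul, smul_eq_mul, mul_left_comm _ c, ← Finset.mul_sum]
      rw [this, mul_zero]

/-- `𝐕_I`. -/
def VI : Submodule ℝ (L2 Ω × L2 Ω) where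
  carrier := {v | v ∈ V0 Ω P T k ∧ ∀ K ∈ T, ZeroOnBoundary K v.1 ∧ ZeroOnBoundary K v.2}
  add_mem' := by
    rintro u v ⟨hu, hu'⟩ ⟨hv, hv'⟩
    refine ⟨add_mem hu hv, fun K hK => ?_⟩
    obtain ⟨⟨p, h1, h2⟩, p', h3, h4⟩ := hu' K hK
    obtain ⟨⟨q, g1, g2⟩, q', g3, g4⟩ := hv' K hK
    refine ⟨⟨p + q, h1.add g1, fun i j hij x hx => ?_⟩,
      p' + q', h3.add g3, fun i j hij x hx => ?_⟩
    · rw [map_add, h2 i j hij x hx, g2 i j hij x hx, add_zero]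
    · rw [map_add, h4 i j hij x hx, g4 i j hij x hx, add_zero]
  zero_mem' := ⟨zero_mem _, fun K _ => ⟨⟨0, hasPiece_zero Ω K, by simp⟩,
    0, hasPiece_zero Ω K, by simp⟩⟩
  smul_mem' := by
    rintro c u ⟨hu, hu'⟩
    refine ⟨Submodule.smul_mem _ c hu, fun K hK => ?_⟩
    obtain ⟨⟨p, h1, h2⟩, p', h3, h4⟩ := hu' K hK
    refine ⟨⟨c • p, h1.smul c, fun i j hij x hx => ?_⟩,
      c • p', h3.smul c, fun i j hij x hx => ?_⟩
    · rw [map_smul, h2 i j hij x hx, smul_zero]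
    · rw [map_smul, h4 i j hij x hx, smul_zero]

/-- `Q_I`; the integral is that of `q` over `K` (`K` lies in the closure of `Ω`). -/
def QI : Submodule ℝ (L2 Ω) where
  carrier := {q | q ∈ Q0 Ω P T k ∧
    ∀ K ∈ T, ∫ x in K.closedInterior, q x ∂(volume.restrict (Ω : Set Pt)) = 0 ∧
      ZeroAtVertices K q}
  add_mem' := by
    rintro u v ⟨hu, hu'⟩ ⟨hv, hv'⟩
    refine ⟨add_mem hu hv, fun K hK => ?_⟩
    obtain ⟨hi, p, h1, h2⟩ := hu' K hK
    obtain ⟨gi, q, g1, g2⟩ := hv' K hK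
    refine ⟨?_, p + q, h1.add g1, fun i => by rw [map_add, h2 i, g2 i, add_zero]⟩
    rw [integral_congr_ae (ae_restrict_of_ae (Lp.coeFn_add u v))]
    simp only [Pi.add_apply]
    rw [integral_add hu.2.1.integrableOn hv.2.1.integrableOn, hi, gi, add_zero]
  zero_mem' := by
    refine ⟨zero_mem _, fun K _ => ⟨?_, 0, hasPiece_zero Ω K, by simp⟩⟩
    rw [integral_congr_ae (ae_restrict_of_ae (Lp.coeFn_zero ℝ 2 _))]
    simp
  smul_mem' := by
    rintro c u ⟨hu, hu'⟩
    refine ⟨Submodule.smul_mem _ c hu, fun K hK => ?_⟩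
    obtain ⟨hi, p, h1, h2⟩ := hu' K hK
    refine ⟨?_, c • p, h1.smul c, fun i => by rw [map_smul, h2 i, smul_zero]⟩
    rw [integral_congr_ae (ae_restrict_of_ae (Lp.coeFn_smul c u))]
    simp only [Pi.smul_apply]
    rw [integral_smul, hi, smul_zero]

/-! ### The exterior spaces -/

/-- `Σ̃_E`. -/
def SigmaE : Submodule ℝ (L2 Ω) where
  carrier := {φ | φ ∈ Sigma0 Ω P T k ∧ ∀ ψ ∈ SigmaI Ω P T k, a (curl φ) (curl ψ) = 0}
  add_mem' := by
    rintro u v ⟨hu, hu'⟩ ⟨hv, hv'⟩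
    refine ⟨add_mem hu hv, fun ψ hψ => ?_⟩
    rw [curl_add hu.1.1.1 hv.1.1.1, a_add_left (curl_mem hu.1.1) (curl_mem hv.1.1),
      hu' ψ hψ, hv' ψ hψ, add_zero]
  zero_mem' := ⟨zero_mem _, fun ψ _ => by rw [curl_zero, a_zero_left]⟩
  smul_mem' := by
    rintro c u ⟨hu, hu'⟩
    refine ⟨Submodule.smul_mem _ c hu, fun ψ hψ => ?_⟩
    rw [curl_smul c hu.1.1.1, a_smul_left c (curl_mem hu.1.1), hu' ψ hψ, mul_zero]

/-- `Q̃_E`. -/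
def QE : Submodule ℝ (L2 Ω) where
  carrier := {q | q ∈ Q0 Ω P T k ∧ ∀ r ∈ QI Ω P T k, inner ℝ q r = 0}
  add_mem' := by
    rintro u v ⟨hu, hu'⟩ ⟨hv, hv'⟩
    refine ⟨add_mem hu hv, fun r hr => ?_⟩
    rw [inner_add_left, hu' r hr, hv' r hr, add_zero]
  zero_mem' := ⟨zero_mem _, fun r _ => inner_zero_left r⟩
  smul_mem' := by
    rintro c u ⟨hu, hu'⟩
    refine ⟨Submodule.smul_mem _ c hu, fun r hr => ?_⟩
    rw [real_inner_smul_left, hu' r hr, mul_zero]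

theorem V0_le : V0 Ω P T k ≤ (H1 Ω).prod (H1 Ω) := fun _ hv => ⟨hv.1.1.1, hv.2.1.1⟩

/-- `𝐕̃_E`. -/
def VE : Submodule ℝ (L2 Ω × L2 Ω) where
  carrier := {v | v ∈ V0 Ω P T k ∧ div v ∈ QE Ω P T k ∧
    ∀ ψ ∈ SigmaI Ω P T k, a v (curl ψ) = 0}
  add_mem' := by
    rintro u v ⟨hu, hd, hu'⟩ ⟨hv, gd, hv'⟩
    have h1 := V0_le Ω P T k hu
    have h2 := V0_le Ω P T k hv
    refine ⟨add_mem hu hv, ?_, fun ψ hψ => ?_⟩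
    · rw [div_add h1 h2]
      exact add_mem hd gd
    · rw [a_add_left h1 h2, hu' ψ hψ, hv' ψ hψ, add_zero]
  zero_mem' := ⟨zero_mem _, by rw [div_zero]; exact zero_mem _, fun ψ _ => a_zero_left _⟩
  smul_mem' := by
    rintro c u ⟨hu, hd, hu'⟩
    have h1 := V0_le Ω P T k hu
    refine ⟨Submodule.smul_mem _ c hu, ?_, fun ψ hψ => ?_⟩
    · rw [div_smul c h1]
      exact Submodule.smul_mem _ c hd
    · rw [a_smul_left c h1, hu' ψ hψ, mul_zero]

end Spaces

/-- `A = B ⊕ C` (internal direct sum of subspaces). -/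
def IsDirectSum {E : Type*} [AddCommGroup E] [Module ℝ E] (A B C : Submodule ℝ E) : Prop :=
  A = B ⊔ C ∧ B ⊓ C = ⊥

end StokesFE

end

/-!
Let `b` be the product of the barycentric coordinates of a triangle `K`. A polynomial vanishes on
`∂K` iff `b` divides it, and its normal derivative vanishes there as well iff `b²` divides it. So
the interior spaces are unconstrained between elements, and on each element they form the complex
`b² P_(k-5) → (b P_(k-3))² → {q ∈ P_(k-1) : q = 0 at the vertices, ∫_K q = 0}` given by `curl` and
`div`, which is exact at the last two places: a divergence-free field in `(b P_(k-3))²` is the curl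
of a polynomial with vanishing gradient on `∂K`, and surjectivity of `div` follows by counting
dimensions. Globally, `div` maps `V_I` onto `Q_I` with kernel `curl Σ_I`.

The decompositions of `Q₀` and `Σ₀` come from orthogonal projection onto the finite-dimensional
spaces `Q_I` and `∇ curl Σ_I`. For `v ∈ V₀`, a field `w ∈ V_I` corrects `div v` by its `Q_I` part,
and subtracting a field of `curl Σ_I` then makes `v - w` orthogonal to `curl Σ_I` without changing
the divergence. The sum is direct because a field in `V_I ∩ V_E` has divergence in `Q_I ∩ Q_E = 0`,
hence is a curl in `curl Σ_I` orthogonal to itself.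
-/

noncomputable section

namespace StokesFE

open MvPolynomial

section Polynomials

variable {σ R : Type*}

section Semiring

variable [CommSemiring R]

variable (σ R) in
/-- Polynomials all of whose monomials have degree less than `m`. The strict bound makes the
space trivial for `m = 0`, so that dimension counts need no case distinction. -/
def degreeLT (m : ℕ) : Submodule R (MvPolynomial σ R) :=
  restrictSupport R {s | s.degree < m}

theorem mem_degreeLT {m : ℕ} {p : MvPolynomial σ R} :
    p ∈ degreeLT σ R m ↔ ∀ s ∈ p.support, s.degree < m :=
  Iff.rfl

theorem mem_degreeLT_succ {m : ℕ} {p : MvPolynomial σ R} :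
    p ∈ degreeLT σ R (m + 1) ↔ p.totalDegree ≤ m := by
  rw [← mem_restrictTotalDegree]
  simp only [mem_degreeLT, Nat.lt_succ_iff]
  rfl

theorem degreeLT_mono : Monotone (degreeLT σ R) := fun _ _ h =>
  restrictSupport_mono R fun _ hs => lt_of_lt_of_le hs h

theorem degreeLT_zero : degreeLT σ R 0 = ⊥ := by
  refine (Submodule.eq_bot_iff _).2 fun p hp => support_eq_empty.1 ?_
  exact Finset.eq_empty_of_forall_notMem fun s hs => Nat.not_lt_zero _ (hp hs)

theorem mem_degreeLT_of_ne_zero {m : ℕ} {p : MvPolynomial σ R} (hp : p ≠ 0) :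
    p ∈ degreeLT σ R m ↔ p.totalDegree < m := by
  cases m with
  | zero => simp [degreeLT_zero, hp]
  | succ m => rw [mem_degreeLT_succ, Nat.lt_succ_iff]

theorem mul_mem_degreeLT_iff [NoZeroDivisors R] {m : ℕ} {b q : MvPolynomial σ R} (hb : b ≠ 0) :
    b * q ∈ degreeLT σ R (m + b.totalDegree) ↔ q ∈ degreeLT σ R m := by
  rcases eq_or_ne q 0 with rfl | hq
  · simp
  · rw [mem_degreeLT_of_ne_zero (mul_ne_zero hb hq), mem_degreeLT_of_ne_zero hq,
      totalDegree_mul_of_isDomain hb hq]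
    omega

theorem eq_zero_of_mul_mem_degreeLT [NoZeroDivisors R] {m : ℕ} {b q : MvPolynomial σ R}
    (h : b * q ∈ degreeLT σ R m) (hb : b ≠ 0) (hm : m ≤ b.totalDegree) : q = 0 := by
  have h0 : b * q ∈ degreeLT σ R (0 + b.totalDegree) := degreeLT_mono (by omega) h
  simpa [degreeLT_zero] using (mul_mem_degreeLT_iff hb).1 h0

theorem degreeLT_inf_span_singleton [NoZeroDivisors R] {b : MvPolynomial σ R} (hb : b ≠ 0)
    (m : ℕ) : degreeLT σ R m ⊓ (Ideal.span {b}).restrictScalars R =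
      (degreeLT σ R (m - b.totalDegree)).map (LinearMap.mulLeft R b) := by
  ext p
  rw [Submodule.mem_inf, Submodule.restrictScalars_mem, Submodule.mem_map]
  constructor
  · rintro ⟨hp, hbp⟩
    obtain ⟨q, rfl⟩ := Ideal.mem_span_singleton.1 hbp
    refine ⟨q, ?_, rfl⟩
    rcases le_total m b.totalDegree with hm | hm
    · simp [eq_zero_of_mul_mem_degreeLT hp hb hm]
    · rwa [← mul_mem_degreeLT_iff hb, Nat.sub_add_cancel hm]
  · rintro ⟨q, hq, rfl⟩
    refine ⟨?_, Ideal.mem_span_singleton.2 (dvd_mul_right b q)⟩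
    rcases le_total m b.totalDegree with hm | hm
    · rw [Nat.sub_eq_zero_of_le hm, degreeLT_zero, Submodule.mem_bot] at hq
      simp [hq]
    · rwa [← mul_mem_degreeLT_iff hb, Nat.sub_add_cancel hm] at hq

instance finite_degreeLT [Finite σ] (m : ℕ) : Module.Finite R (degreeLT σ R m) :=
  have := (Finsupp.finite_of_degree_lt (σ := σ) m).to_subtype
  Module.Finite.of_basis (basisRestrictSupport R _)

theorem pderiv_mem_degreeLT {m : ℕ} (i : σ) {p : MvPolynomial σ R}
    (hp : p ∈ degreeLT σ R (m + 1)) : pderiv i p ∈ degreeLT σ R m := by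
  intro s hs
  have hs' : s + Finsupp.single i 1 ∈ p.support := by
    have hcoeff : coeff s (pderiv i p) ≠ 0 := mem_support_iff.1 hs
    rw [coeff_pderiv] at hcoeff
    exact mem_support_iff.2 (left_ne_zero_of_mul hcoeff)
  simpa using hp hs'

end Semiring

theorem finrank_degreeLT [CommRing R] [Nontrivial R] [Fintype σ] (m : ℕ) :
    Module.finrank R (degreeLT σ R m) =
      ∑ j ∈ Finset.range m, (Fintype.card σ).multichoose j := by
  classical
  let F : Finset (σ →₀ ℕ) := (Finset.range m).biUnion (Finset.finsuppAntidiag Finset.univ)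
  have hF : {s : σ →₀ ℕ | s.degree < m} = F := by
    ext s
    simp [F, Finset.mem_finsuppAntidiag, Finsupp.degree_eq_sum]
  have hdisj : ((Finset.range m : Finset ℕ) : Set ℕ).PairwiseDisjoint
      (Finset.finsuppAntidiag (Finset.univ : Finset σ)) := by
    intro i _ j _ hij
    refine Finset.disjoint_left.2 fun s hi hj => hij ?_
    rw [← (Finset.mem_finsuppAntidiag.1 hi).1, (Finset.mem_finsuppAntidiag.1 hj).1]
  calc Module.finrank R (degreeLT σ R m)
      = Nat.card {s : σ →₀ ℕ | s.degree < m} :=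
        Module.finrank_eq_nat_card_basis (basisRestrictSupport R _)
    _ = F.card := by rw [hF]; simp
    _ = _ := by
      rw [Finset.card_biUnion hdisj]
      exact Finset.sum_congr rfl fun j _ => by
        rw [Finset.card_finsuppAntidiag_nat_eq_multichoose, Finset.card_univ]

theorem two_mul_finrank_degreeLT_fin_two [CommRing R] [Nontrivial R] (m : ℕ) :
    2 * Module.finrank R (degreeLT (Fin 2) R m) = m * (m + 1) := by
  rw [finrank_degreeLT]
  induction m with
  | zero => simp
  | succ m ih =>
    rw [Finset.sum_range_succ, mul_add, ih, Fintype.card_fin, Nat.multichoose_two]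
    ring

theorem pderiv_comm [CommRing R] (i j : σ) (p : MvPolynomial σ R) :
    pderiv i (pderiv j p) = pderiv j (pderiv i p) := by
  classical
  have h : ⁅pderiv (R := R) i, pderiv (R := R) j⁆ = 0 := by
    refine derivation_ext fun l => ?_
    rw [Derivation.commutator_apply, pderiv_X, pderiv_X, Pi.single_apply, Pi.single_apply]
    split_ifs <;> simp
  rw [← sub_eq_zero, ← Derivation.commutator_apply, h, Derivation.zero_apply]

section Antiderivative

variable {𝕜 : Type*} [Field 𝕜]

/-- The antiderivative with respect to the variable `i` that vanishes on the hyperplane where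
this variable is zero. -/
def antideriv (i : σ) : MvPolynomial σ 𝕜 →ₗ[𝕜] MvPolynomial σ 𝕜 :=
  (basisMonomials σ 𝕜).constr 𝕜 fun s => monomial (s + Finsupp.single i 1) (s i + 1 : 𝕜)⁻¹

theorem antideriv_monomial (i : σ) (s : σ →₀ ℕ) (c : 𝕜) :
    antideriv i (monomial s c) = monomial (s + Finsupp.single i 1) (c * (s i + 1 : 𝕜)⁻¹) := by
  have h : monomial s c = c • basisMonomials σ 𝕜 s := by simp [smul_monomial]
  rw [h, map_smul, antideriv, Module.Basis.constr_basis, smul_monomial, smul_eq_mul]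

theorem antideriv_mem_degreeLT {m : ℕ} (i : σ) {p : MvPolynomial σ 𝕜}
    (hp : p ∈ degreeLT σ 𝕜 m) : antideriv i p ∈ degreeLT σ 𝕜 (m + 1) := by
  rw [p.as_sum, map_sum]
  refine sum_mem fun s hs => ?_
  rw [antideriv_monomial, degreeLT, monomial_mem_restrictSupport]
  exact Or.inl (by simpa using hp hs)

theorem pderiv_antideriv_of_ne {i j : σ} (h : j ≠ i) (p : MvPolynomial σ 𝕜) :
    pderiv j (antideriv i p) = antideriv i (pderiv j p) := by
  classical
  induction p using MvPolynomial.induction_on' with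
  | add p q hp hq => simp only [map_add, hp, hq]
  | monomial s c =>
    simp only [antideriv_monomial, pderiv_monomial]
    by_cases hs : s j = 0
    · simp [hs, h.symm]
    · have hexp : s + Finsupp.single i 1 - Finsupp.single j 1 =
          s - Finsupp.single j 1 + Finsupp.single i 1 :=
        tsub_add_eq_add_tsub (Finsupp.single_le_iff.2 (Nat.one_le_iff_ne_zero.2 hs)) |>.symm
      rw [hexp]
      simp [h, h.symm, mul_right_comm]

variable [CharZero 𝕜]

theorem pderiv_antideriv (i : σ) (p : MvPolynomial σ 𝕜) : pderiv i (antideriv i p) = p := by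
  induction p using MvPolynomial.induction_on' with
  | add p q hp hq => rw [map_add, map_add, hp, hq]
  | monomial s c =>
    have hs : (s i + 1 : 𝕜) ≠ 0 := Nat.cast_add_one_ne_zero _
    rw [antideriv_monomial, pderiv_monomial]
    simp [hs]

theorem exists_pderiv_eq_of_divergence_eq_zero {m : ℕ} {p q : MvPolynomial (Fin 2) 𝕜}
    (hp : p ∈ degreeLT (Fin 2) 𝕜 m) (hq : q ∈ degreeLT (Fin 2) 𝕜 m)
    (h : pderiv 0 p + pderiv 1 q = 0) :
    ∃ φ ∈ degreeLT (Fin 2) 𝕜 (m + 1), pderiv 1 φ = p ∧ pderiv 0 φ = -q := by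
  refine ⟨antideriv 1 p - antideriv 0 (pderiv 0 (antideriv 1 p) + q), ?_, ?_, ?_⟩
  · exact sub_mem (antideriv_mem_degreeLT 1 hp) (antideriv_mem_degreeLT 0
      (add_mem (pderiv_mem_degreeLT 0 (antideriv_mem_degreeLT 1 hp)) hq))
  · rw [map_sub, pderiv_antideriv, pderiv_antideriv_of_ne (by decide), map_add, pderiv_comm,
      pderiv_antideriv, h, map_zero, sub_zero]
  · rw [map_sub, pderiv_antideriv, sub_add_cancel_left]

theorem eq_C_of_pderiv_eq_zero {p : MvPolynomial σ 𝕜} (h : ∀ i, pderiv i p = 0) :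
    p = C (p.coeff 0) := by
  classical
  ext s
  rw [coeff_C]
  split_ifs with hs
  · rw [← hs]
  obtain ⟨i, hi⟩ := DFunLike.ne_iff.1 (Ne.symm hs)
  have hle : Finsupp.single i 1 ≤ s := Finsupp.single_le_iff.2 (Nat.one_le_iff_ne_zero.2 hi)
  have hcoeff := congrArg (coeff (s - Finsupp.single i 1)) (h i)
  rw [coeff_pderiv, coeff_zero, tsub_add_cancel_of_le hle] at hcoeff
  exact (mul_eq_zero.1 hcoeff).resolve_right (Nat.cast_add_one_ne_zero _)

end Antiderivative

theorem dvd_aeval_sub_aeval {A : Type*} [CommRing R] [CommRing A] [Algebra R A] {c : A}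
    {f g : σ → A} (h : ∀ i, c ∣ f i - g i) (p : MvPolynomial σ R) : c ∣ aeval f p - aeval g p := by
  simp only [← Ideal.mem_span_singleton, ← Ideal.Quotient.eq] at h ⊢
  have hcomp := fun f : σ → A => comp_aeval_apply f (Ideal.Quotient.mkₐ R (Ideal.span {c})) p
  simp only [Ideal.Quotient.mkₐ_eq_mk] at hcomp
  rw [hcomp f, hcomp g, funext h]

theorem derivation_mem_pow {A : Type*} [CommRing R] [CommRing A] [Algebra R A]
    (D : Derivation R A A) (I : Ideal A) (m : ℕ) {x : A} (hx : x ∈ I ^ (m + 1)) :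
    D x ∈ I ^ m := by
  induction m generalizing x with
  | zero => simp
  | succ m ih =>
    rw [pow_succ'] at hx
    refine Submodule.mul_induction_on hx (fun y hy z hz => ?_) fun y z hy hz => ?_
    · rw [D.leibniz, smul_eq_mul, smul_eq_mul]
      refine add_mem ?_ (Ideal.mul_mem_right _ _ hz)
      rw [pow_succ']
      exact Ideal.mul_mem_mul hy (ih hz)
    · rw [map_add]
      exact add_mem hy hz

theorem derivation_pow_mem_pow {A : Type*} [CommRing R] [CommRing A] [Algebra R A]
    (D : Derivation R A A) (I : Ideal A) (m j : ℕ) {x : A} (hx : x ∈ I ^ (m + j)) :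
    ((D : A →ₗ[R] A) ^ j) x ∈ I ^ m := by
  induction j generalizing x with
  | zero => simpa using hx
  | succ j ih =>
    rw [pow_succ, Module.End.mul_apply]
    exact ih (derivation_mem_pow D I _ hx)

end Polynomials

section Evaluation

theorem evalAt_mul (x : Pt) (p q : Poly) : evalAt x (p * q) = evalAt x p * evalAt x q :=
  map_mul (aeval (R := ℝ) fun i => x i) p q

theorem evalAt_X (x : Pt) (i : Fin 2) : evalAt x (X i) = x i :=
  aeval_X _ i

theorem evalAt_C (x : Pt) (c : ℝ) : evalAt x (C c) = c :=
  aeval_C _ c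

theorem evalAt_aeval (x : Pt) (f : Fin 2 → Poly) (p : Poly) :
    evalAt x (aeval f p) = evalAt (WithLp.toLp 2 fun l => evalAt x (f l)) p :=
  comp_aeval_apply f (aeval fun i => x i) p

theorem pd_mul (i : Fin 2) (p q : Poly) : pd i (p * q) = pd i p * q + p * pd i q :=
  pderiv_mul

theorem pd_C (i : Fin 2) (c : ℝ) : pd i (C c) = 0 :=
  pderiv_C

theorem pd_X (i j : Fin 2) : pd i (X j) = if j = i then 1 else 0 := by
  rw [pd, Derivation.coeFn_coe, pderiv_X, Pi.single_apply]

theorem hasFDerivAt_evalAt (p : Poly) (x : Pt) :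
    HasFDerivAt (fun y => evalAt y p)
      (∑ l, evalAt x (pd l p) • (EuclideanSpace.proj l : Pt →L[ℝ] ℝ)) x := by
  induction p using MvPolynomial.induction_on with
  | C c => simpa only [evalAt_C, pd_C, map_zero, zero_smul, Finset.sum_const_zero] using
      hasFDerivAt_const c x
  | add p q hp hq => simpa only [map_add, add_smul, Finset.sum_add_distrib] using hp.fun_add hq
  | mul_X p j hp =>
    have hX := (EuclideanSpace.proj (𝕜 := ℝ) j : Pt →L[ℝ] ℝ).hasFDerivAt (x := x)
    simp only [evalAt_mul, evalAt_X]
    refine (hp.mul hX).congr_fderiv ?_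
    ext y
    fin_cases j <;> simp [pd_X, pd_mul, evalAt_mul, evalAt_X] <;> ring

theorem cpartial_evalAt (i : Fin 2) (p : Poly) :
    cpartial i (fun x => evalAt x p) = fun x => evalAt x (pd i p) := by
  funext x
  rw [cpartial, (hasFDerivAt_evalAt p x).fderiv]
  fin_cases i <;> simp

theorem contDiff_evalAt (p : Poly) : ContDiff ℝ ∞ (fun x => evalAt x p) := by
  induction p using MvPolynomial.induction_on with
  | C c => simpa only [evalAt_C] using contDiff_const
  | add p q hp hq => simpa only [map_add] using hp.add hq
  | mul_X p j hp =>
    simp only [evalAt_mul, evalAt_X]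
    exact hp.mul (EuclideanSpace.proj (𝕜 := ℝ) j : Pt →L[ℝ] ℝ).contDiff

theorem continuous_evalAt (p : Poly) : Continuous (fun x => evalAt x p) :=
  (contDiff_evalAt p).continuous

theorem eq_zero_of_evalAt_eq_zero_on_open {p : Poly} {U : Set Pt} (hU : IsOpen U)
    (hne : U.Nonempty) (h : ∀ x ∈ U, evalAt x p = 0) : p = 0 := by
  let e := EuclideanSpace.equiv (Fin 2) ℝ
  obtain ⟨x, hx⟩ := hne
  obtain ⟨ε, hε, hball⟩ :=
    Metric.isOpen_iff.1 (hU.preimage e.symm.continuous) (e x) (by simpa using hx)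
  refine funext_set (s := fun i => Metric.ball (e x i) ε) (fun i => ?_) fun y hy => ?_
  · rw [Real.ball_eq_Ioo]
    exact Set.Ioo_infinite (by linarith)
  · rw [map_zero, ← h _ (hball (ball_pi (e x) hε ▸ hy))]
    rfl

theorem exists_polynomial_eval_eq_evalAt_lineMap (A B : Pt) (p : Poly) :
    ∃ f : Polynomial ℝ, ∀ t, f.eval t = evalAt (AffineMap.lineMap A B t) p := by
  induction p using MvPolynomial.induction_on with
  | C c => exact ⟨.C c, fun t => by rw [Polynomial.eval_C, evalAt_C]⟩
  | add p q hp hq =>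
    obtain ⟨f, hf⟩ := hp
    obtain ⟨g, hg⟩ := hq
    exact ⟨f + g, fun t => by rw [Polynomial.eval_add, hf, hg, map_add]⟩
  | mul_X p j hp =>
    obtain ⟨f, hf⟩ := hp
    refine ⟨f * (.X * .C (B j - A j) + .C (A j)), fun t => ?_⟩
    rw [Polynomial.eval_mul, hf, evalAt_mul, evalAt_X]
    simp [AffineMap.lineMap_apply]

theorem evalAt_eq_zero_on_line {p : Poly} {A B : Pt}
    (h : ∀ t ∈ Set.Ioo (0 : ℝ) 1, evalAt (AffineMap.lineMap A B t) p = 0) (t : ℝ) :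
    evalAt (AffineMap.lineMap A B t) p = 0 := by
  obtain ⟨f, hf⟩ := exists_polynomial_eval_eq_evalAt_lineMap A B p
  have hroot : Set.Ioo (0 : ℝ) 1 ⊆ {t | f.IsRoot t} := fun t ht => (hf t).trans (h t ht)
  rw [← hf, f.eq_zero_of_infinite_isRoot ((Set.Ioo_infinite one_pos).mono hroot),
    Polynomial.eval_zero]

theorem hasDerivAt_evalAt_lineMap (p : Poly) (A B : Pt) (t : ℝ) :
    HasDerivAt (fun s => evalAt (AffineMap.lineMap A B s) p)
      (∑ l, (B - A) l * evalAt (AffineMap.lineMap A B t) (pd l p)) t := by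
  have h := (hasFDerivAt_evalAt p _).comp_hasDerivAt t
    (AffineMap.hasDerivAt_lineMap (a := A) (b := B) (x := t))
  refine h.congr_deriv ?_
  simp [mul_comm]

/-- The polynomial that represents a real affine function on the plane. -/
def affinePoly (f : Pt →ᵃ[ℝ] ℝ) : Poly :=
  C (f 0) + ∑ l, C (f.linear (EuclideanSpace.single l 1)) * X l

theorem evalAt_affinePoly (f : Pt →ᵃ[ℝ] ℝ) (x : Pt) : evalAt x (affinePoly f) = f x := by
  have hx : f x = f.linear x + f 0 := congrFun f.decomp x
  have hlin : f.linear x = ∑ l, x l * f.linear (EuclideanSpace.single l 1) := by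
    conv_lhs => rw [← (EuclideanSpace.basisFun (Fin 2) ℝ).sum_repr x]
    simp only [map_sum, map_smul, smul_eq_mul, EuclideanSpace.basisFun_repr,
      EuclideanSpace.basisFun_apply]
  simp only [affinePoly, map_add, map_sum, evalAt_mul, evalAt_C, evalAt_X, hx, hlin,
    mul_comm, add_comm]

theorem pd_affinePoly (f : Pt →ᵃ[ℝ] ℝ) (l : Fin 2) :
    pd l (affinePoly f) = C (f.linear (EuclideanSpace.single l 1)) := by
  rw [affinePoly, map_add, pd_C, zero_add, map_sum, Fin.sum_univ_two, pd_mul, pd_mul, pd_C, pd_C]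
  fin_cases l <;> simp [pd_X]

theorem affinePoly_mem_degreeLT (f : Pt →ᵃ[ℝ] ℝ) : affinePoly f ∈ degreeLT (Fin 2) ℝ 2 := by
  have hC : ∀ c : ℝ, (C c : Poly).totalDegree ≤ 1 := fun c => (totalDegree_C c).trans_le zero_le_one
  have hX : ∀ (c : ℝ) (l : Fin 2), (C c * X l : Poly).totalDegree ≤ 1 := fun c l =>
    (totalDegree_mul _ _).trans_eq (by rw [totalDegree_C, totalDegree_X])
  exact add_mem (mem_degreeLT_succ.2 (hC _)) (sum_mem fun l _ => mem_degreeLT_succ.2 (hX _ l))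

end Evaluation

section Triangle

/-- The vertices of a triangle, as an affine basis of the plane. -/
def Tri.basis (K : Tri) : AffineBasis (Fin 3) ℝ Pt :=
  ⟨K.points, K.independent,
    K.independent.affineSpan_eq_top_iff_card_eq_finrank_add_one.2 (by simp)⟩

/-- The barycentric coordinate of a triangle that is `1` at its vertex `i`, as a polynomial. -/
def bary (K : Tri) (i : Fin 3) : Poly :=
  affinePoly (K.basis.coord i)

variable (K : Tri)

theorem evalAt_bary (i : Fin 3) (x : Pt) : evalAt x (bary K i) = K.basis.coord i x :=
  evalAt_affinePoly _ x

theorem evalAt_bary_points (i j : Fin 3) :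
    evalAt (K.points j) (bary K i) = if i = j then 1 else 0 :=
  (evalAt_bary K i _).trans (K.basis.coord_apply i j)

theorem evalAt_bary_lineMap (i : Fin 3) (A B : Pt) (t : ℝ) :
    evalAt (AffineMap.lineMap A B t) (bary K i) =
      AffineMap.lineMap (evalAt A (bary K i)) (evalAt B (bary K i)) t := by
  simp only [evalAt_bary, AffineMap.apply_lineMap]

theorem sum_evalAt_bary (x : Pt) : ∑ i, evalAt x (bary K i) = 1 := by
  simp only [evalAt_bary, K.basis.sum_coord_apply_eq_one]

theorem closedInterior_eq : K.closedInterior = {x | ∀ i, 0 ≤ evalAt x (bary K i)} := by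
  simp only [evalAt_bary, ← Affine.Simplex.convexHull_eq_closedInterior]
  exact K.basis.convexHull_eq_nonneg_coord

theorem interior_eq : K.interior = {x | ∀ i, 0 < evalAt x (bary K i)} := by
  ext x
  have hsum := sum_evalAt_bary K x
  have hx := Affine.Simplex.affineCombination_mem_interior_iff (s := K)
    (K.basis.sum_coord_apply_eq_one x)
  rw [show (Finset.univ.affineCombination ℝ K.points) (fun i => K.basis.coord i x) = x from
    K.basis.affineCombination_coord_eq_self x] at hx
  simp only [hx, ← evalAt_bary, Set.mem_ofPred_eq, Set.mem_Ioo]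
  refine ⟨fun h i => (h i).1, fun h i => ⟨h i, hsum ▸ ?_⟩⟩
  exact Finset.single_lt_sum (j := i + 1) (by simp) (Finset.mem_univ i) (Finset.mem_univ _) (h _)
    fun j _ _ => (h j).le

theorem interior_closedInterior : interior K.closedInterior = K.interior := by
  rw [← Affine.Simplex.convexHull_eq_closedInterior, interior_eq]
  simp only [evalAt_bary]
  exact K.basis.interior_convexHull

theorem isOpen_interior : IsOpen K.interior :=
  interior_closedInterior K ▸ _root_.isOpen_interior

theorem interior_nonempty : K.interior.Nonempty := by
  rw [← interior_closedInterior, ← Affine.Simplex.convexHull_eq_closedInterior]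
  exact ⟨_, K.basis.centroid_mem_interior_convexHull⟩

theorem interior_ae_eq_closedInterior :
    (K.interior : Set Pt) =ᵐ[volume] (K.closedInterior : Set Pt) := by
  have hconv : Convex ℝ K.closedInterior :=
    Affine.Simplex.convexHull_eq_closedInterior K ▸ convex_convexHull ℝ _
  rw [← interior_closedInterior]
  exact interior_ae_eq_of_null_frontier (hconv.addHaar_frontier volume)

theorem volume_segment (x y : Pt) : volume (segment ℝ x y) = 0 := by
  have hsub : segment ℝ x y ⊆ line[ℝ, x, y] := by
    rw [← convexHull_pair]
    exact convexHull_subset_affineSpan _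
  refine measure_mono_null hsub (Measure.addHaar_affineSubspace volume _ fun h => ?_)
  have hline := (collinear_pair ℝ x y).finrank_le_one
  rw [← direction_affineSpan, h, AffineSubspace.direction_top, finrank_top] at hline
  simp at hline

theorem bary_ne_zero (i : Fin 3) : bary K i ≠ 0 := fun h => by
  simpa [h] using evalAt_bary_points K i i

theorem exists_pd_bary_ne_zero (i : Fin 3) : ∃ l, pd l (bary K i) ≠ 0 := by
  by_contra! h
  have hconst := eq_C_of_pderiv_eq_zero h
  have hself := evalAt_bary_points K i i
  have hnext := evalAt_bary_points K i (i + 1)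
  rw [hconst, evalAt_C] at hself hnext
  simp [hself] at hnext

theorem totalDegree_bary (i : Fin 3) : (bary K i).totalDegree = 1 := by
  refine le_antisymm (mem_degreeLT_succ.1 (affinePoly_mem_degreeLT _)) ?_
  by_contra! h
  obtain ⟨l, hl⟩ := exists_pd_bary_ne_zero K i
  rw [totalDegree_eq_zero_iff_eq_C.1 (Nat.lt_one_iff.1 h), pd_C] at hl
  exact hl rfl

/-- The parametrisation over `[0, 1]` of the edge of a triangle opposite to its vertex `i`; the
indices of the vertices are taken modulo `3`. -/
def edge (i : Fin 3) : ℝ →ᵃ[ℝ] Pt :=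
  AffineMap.lineMap (K.points (i + 1)) (K.points (i + 2))

theorem edge_mem_segment (i : Fin 3) {t : ℝ} (ht : t ∈ Set.Ioo (0 : ℝ) 1) :
    edge K i t ∈ segment ℝ (K.points (i + 1)) (K.points (i + 2)) :=
  segment_eq_image_lineMap ℝ (K.points (i + 1)) (K.points (i + 2)) ▸
    ⟨t, Set.Ioo_subset_Icc_self ht, rfl⟩

theorem evalAt_edge_bary_self (i : Fin 3) (t : ℝ) : evalAt (edge K i t) (bary K i) = 0 := by
  rw [edge, evalAt_bary_lineMap, evalAt_bary_points, evalAt_bary_points]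
  simp

theorem evalAt_edge_bary_add_one (i : Fin 3) (t : ℝ) :
    evalAt (edge K i t) (bary K (i + 1)) = 1 - t := by
  rw [edge, evalAt_bary_lineMap, evalAt_bary_points, evalAt_bary_points]
  simp [AffineMap.lineMap_apply_ring]

theorem evalAt_edge_bary_add_two (i : Fin 3) (t : ℝ) :
    evalAt (edge K i t) (bary K (i + 2)) = t := by
  rw [edge, evalAt_bary_lineMap, evalAt_bary_points, evalAt_bary_points]
  simp [AffineMap.lineMap_apply_ring]

theorem eq_add_one_or_eq_add_two_of_ne {i j : Fin 3} (h : j ≠ i) : j = i + 1 ∨ j = i + 2 := by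
  decide +revert

theorem evalAt_edge_bary_ne_zero {i j : Fin 3} (h : j ≠ i) {t : ℝ} (ht : t ∈ Set.Ioo (0 : ℝ) 1) :
    evalAt (edge K i t) (bary K j) ≠ 0 := by
  rcases eq_add_one_or_eq_add_two_of_ne h with rfl | rfl
  · rw [evalAt_edge_bary_add_one]
    exact (sub_pos.2 ht.2).ne'
  · rw [evalAt_edge_bary_add_two]
    exact ht.1.ne'

theorem eq_edge (i : Fin 3) {x : Pt} (hx : evalAt x (bary K i) = 0) :
    x = edge K i (evalAt x (bary K (i + 2))) := by
  have hsum := sum_evalAt_bary K x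
  rw [← Equiv.sum_comp (Equiv.addLeft i), Fin.sum_univ_three] at hsum
  simp only [Equiv.coe_addLeft, add_zero, hx, zero_add] at hsum
  refine K.basis.ext_elem fun j => ?_
  rw [← evalAt_bary, ← evalAt_bary]
  rcases eq_or_ne j i with rfl | hj
  · rw [hx, evalAt_edge_bary_self]
  rcases eq_add_one_or_eq_add_two_of_ne hj with rfl | rfl
  · rw [evalAt_edge_bary_add_one, ← hsum, add_sub_cancel_right]
  · rw [evalAt_edge_bary_add_two]

theorem bary_dvd_of_edge (i : Fin 3) {p : Poly}
    (h : ∀ t ∈ Set.Ioo (0 : ℝ) 1, evalAt (edge K i t) p = 0) : bary K i ∣ p := by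
  let d : Pt := K.points i - K.points (i + 1)
  -- `x ↦ x - λᵢ(x) • d` projects the plane onto the line through the edge and is congruent to
  -- the identity modulo `λᵢ`.
  let f : Fin 2 → Poly := fun l => X l - C (d l) * bary K i
  have hd : (K.basis.coord i).linear d = 1 := by
    have hcoord := (K.basis.coord i).linearMap_vsub (K.points i) (K.points (i + 1))
    rw [vsub_eq_sub, vsub_eq_sub, ← evalAt_bary, ← evalAt_bary, evalAt_bary_points,
      evalAt_bary_points] at hcoord
    rw [hcoord, if_pos rfl, if_neg (by simp), sub_zero]
  have hproj : aeval f p = 0 := by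
    refine eq_zero_of_evalAt_eq_zero_on_open isOpen_univ Set.univ_nonempty fun x _ => ?_
    have hfx : (WithLp.toLp 2 fun l => evalAt x (f l) : Pt) = -(evalAt x (bary K i) • d) +ᵥ x := by
      ext l
      simp [f, evalAt_mul, evalAt_X, evalAt_C]
      ring
    have hline : evalAt (-(evalAt x (bary K i) • d) +ᵥ x) (bary K i) = 0 := by
      rw [evalAt_bary, AffineMap.map_vadd, map_neg, map_smul, hd, evalAt_bary]
      simp
    rw [evalAt_aeval, hfx, eq_edge K i hline]
    exact evalAt_eq_zero_on_line h _
  have hmod : bary K i ∣ aeval X p - aeval f p :=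
    dvd_aeval_sub_aeval (fun l => ⟨C (d l), by simp only [f]; ring⟩) p
  rwa [hproj, sub_zero, aeval_X_left_apply] at hmod

end Triangle

section Bubble

/-- The cubic bubble function `λ₀ λ₁ λ₂` of a triangle. -/
def bubble (K : Tri) : Poly :=
  ∏ i, bary K i

variable (K : Tri)

theorem evalAt_bubble (x : Pt) : evalAt x (bubble K) = ∏ i, evalAt x (bary K i) :=
  map_prod (aeval (R := ℝ) fun i => x i) _ _

theorem bubble_eq (i : Fin 3) : bubble K = bary K i * (bary K (i + 1) * bary K (i + 2)) := by
  rw [bubble, ← Equiv.prod_comp (Equiv.addLeft i), Fin.prod_univ_three]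
  simp only [Equiv.coe_addLeft, add_zero, mul_assoc]

theorem bubble_ne_zero : bubble K ≠ 0 :=
  Finset.prod_ne_zero_iff.2 fun i _ => bary_ne_zero K i

theorem totalDegree_bubble_pow (j : ℕ) : (bubble K ^ j).totalDegree = 3 * j := by
  have hbubble : (bubble K).totalDegree = 3 := by
    rw [bubble, Fin.prod_univ_three, totalDegree_mul_of_isDomain
      (mul_ne_zero (bary_ne_zero K 0) (bary_ne_zero K 1)) (bary_ne_zero K 2),
      totalDegree_mul_of_isDomain (bary_ne_zero K 0) (bary_ne_zero K 1)]
    simp only [totalDegree_bary]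
  induction j with
  | zero => simp
  | succ j ih =>
    rw [pow_succ, totalDegree_mul_of_isDomain (pow_ne_zero j (bubble_ne_zero K))
      (bubble_ne_zero K), ih, hbubble, mul_add_one]

theorem evalAt_edge_bubble (i : Fin 3) (t : ℝ) : evalAt (edge K i t) (bubble K) = 0 := by
  rw [bubble_eq K i, evalAt_mul, evalAt_edge_bary_self, zero_mul]

theorem evalAt_bubble_of_mem_segment {i j : Fin 3} (hij : i ≠ j) {x : Pt}
    (hx : x ∈ segment ℝ (K.points i) (K.points j)) : evalAt x (bubble K) = 0 := by
  rw [segment_eq_image_lineMap] at hx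
  obtain ⟨t, -, rfl⟩ := hx
  obtain ⟨l, hli, hlj⟩ : ∃ l : Fin 3, l ≠ i ∧ l ≠ j := by decide +revert
  rw [bubble_eq K l, evalAt_mul, evalAt_bary_lineMap, evalAt_bary_points, evalAt_bary_points,
    if_neg hli, if_neg hlj, AffineMap.lineMap_same_apply, zero_mul]

theorem evalAt_bubble_pos {x : Pt} (hx : x ∈ K.interior) : 0 < evalAt x (bubble K) := by
  rw [interior_eq] at hx
  rw [evalAt_bubble]
  exact Finset.prod_pos fun i _ => hx i

theorem mem_interior_of_bubble_pos {x : Pt} (hx : x ∈ K.closedInterior)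
    (hb : 0 < evalAt x (bubble K)) : x ∈ K.interior := by
  rw [closedInterior_eq] at hx
  rw [interior_eq]
  rw [evalAt_bubble] at hb
  exact fun i => (hx i).lt_of_ne' (Finset.prod_ne_zero_iff.1 hb.ne' i (Finset.mem_univ i))

theorem bubble_dvd {p : Poly}
    (h : ∀ i, ∀ t ∈ Set.Ioo (0 : ℝ) 1, evalAt (edge K i t) p = 0) : bubble K ∣ p := by
  suffices hs : ∀ s : Finset (Fin 3), ∏ i ∈ s, bary K i ∣ p from hs _
  intro s
  induction s using Finset.induction_on with
  | empty => simp
  | insert i s hi ih =>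
    obtain ⟨q, rfl⟩ := ih
    rw [Finset.prod_insert hi, mul_comm (bary K i)]
    refine mul_dvd_mul_left _ (bary_dvd_of_edge K i fun t ht => ?_)
    refine (mul_eq_zero.1 ((evalAt_mul _ _ _).symm.trans (h i t ht))).resolve_left ?_
    have hprod :
        evalAt (edge K i t) (∏ j ∈ s, bary K j) = ∏ j ∈ s, evalAt (edge K i t) (bary K j) :=
      map_prod (aeval (R := ℝ) fun l => edge K i t l) _ _
    rw [hprod]
    exact Finset.prod_ne_zero_iff.2 fun j hj =>
      evalAt_edge_bary_ne_zero K (ne_of_mem_of_not_mem hj hi) ht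

theorem bubble_sq_dvd {p : Poly} (h : ∀ i, ∀ t ∈ Set.Ioo (0 : ℝ) 1, evalAt (edge K i t) p = 0)
    (hpd : ∀ l i, ∀ t ∈ Set.Ioo (0 : ℝ) 1, evalAt (edge K i t) (pd l p) = 0) :
    bubble K ^ 2 ∣ p := by
  obtain ⟨q, rfl⟩ := bubble_dvd K h
  rw [sq]
  refine mul_dvd_mul_left _ (bubble_dvd K fun i t ht => ?_)
  obtain ⟨l, hl⟩ := exists_pd_bary_ne_zero K i
  rw [bary, pd_affinePoly, Ne, C_eq_zero] at hl
  -- On the edge `λᵢ = 0` the derivative of `λᵢ λⱼ λₖ q` is `∂λᵢ λⱼ λₖ q`.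
  have hpdl := hpd l i t ht
  rw [bubble_eq K i, mul_assoc, pd_mul, map_add, evalAt_mul, evalAt_mul _ (bary K i),
    evalAt_edge_bary_self, zero_mul, add_zero, evalAt_mul, evalAt_mul, bary, pd_affinePoly,
    evalAt_C] at hpdl
  exact (mul_eq_zero.1 ((mul_eq_zero.1 hpdl).resolve_left hl)).resolve_left (mul_ne_zero
    (evalAt_edge_bary_ne_zero K (by simp) ht) (evalAt_edge_bary_ne_zero K (by simp) ht))

/-- The ideal of the polynomials that vanish at a point. -/
def pointIdeal (x : Pt) : Ideal Poly :=
  RingHom.ker (aeval (R := ℝ) fun i => x i)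

theorem mem_pointIdeal {x : Pt} {p : Poly} : p ∈ pointIdeal x ↔ evalAt x p = 0 :=
  Iff.rfl

theorem evalAt_pd_pow_eq_zero {x : Pt} {m : ℕ} {p : Poly} (hp : p ∈ pointIdeal x ^ (m + 1))
    {i j : ℕ} (hij : i + j ≤ m) : evalAt x ((pd 0 ^ i) ((pd 1 ^ j) p)) = 0 := by
  rw [← mem_pointIdeal, ← pow_one (pointIdeal x)]
  refine derivation_pow_mem_pow (pderiv 0) _ 1 i (derivation_pow_mem_pow (pderiv 1) _ _ j ?_)
  exact Ideal.pow_le_pow_right (by omega) hp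

/-- The polynomials of degree less than `m` on a triangle that are divisible by the `j`-th power of
its bubble function. For `j = 1` and `j = 2` these are the polynomials that vanish on the boundary
of the triangle, respectively that vanish there together with their gradient. -/
def bubbleSpace (j m : ℕ) : Submodule ℝ Poly :=
  degreeLT (Fin 2) ℝ m ⊓ (Ideal.span {bubble K ^ j}).restrictScalars ℝ

variable {K}

theorem mem_bubbleSpace {j m : ℕ} {p : Poly} :
    p ∈ bubbleSpace K j m ↔ p ∈ degreeLT (Fin 2) ℝ m ∧ bubble K ^ j ∣ p := by
  rw [bubbleSpace, Submodule.mem_inf, Submodule.restrictScalars_mem, Ideal.mem_span_singleton]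

instance finite_bubbleSpace (j m : ℕ) : Module.Finite ℝ (bubbleSpace K j m) :=
  Submodule.finiteDimensional_inf_left _ _

theorem finrank_bubbleSpace (j m : ℕ) : Module.finrank ℝ (bubbleSpace K j m) =
    Module.finrank ℝ (degreeLT (Fin 2) ℝ (m - 3 * j)) := by
  have hb : bubble K ^ j ≠ 0 := pow_ne_zero j (bubble_ne_zero K)
  rw [bubbleSpace, degreeLT_inf_span_singleton hb, totalDegree_bubble_pow]
  exact (Submodule.equivMapOfInjective _ (mul_right_injective₀ hb) _).finrank_eq.symm

theorem pd_mem_bubbleSpace {j m : ℕ} {p : Poly} (hp : p ∈ bubbleSpace K (j + 1) (m + 1))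
    (l : Fin 2) : pd l p ∈ bubbleSpace K j m := by
  rw [bubbleSpace, Submodule.mem_inf, Submodule.restrictScalars_mem,
    ← Ideal.span_singleton_pow] at hp ⊢
  exact ⟨pderiv_mem_degreeLT l hp.1, derivation_mem_pow (pderiv l) _ j hp.2⟩

theorem mem_pointIdeal_of_mem_bubbleSpace {j m : ℕ} {p : Poly} (hp : p ∈ bubbleSpace K j m)
    (i : Fin 3) : p ∈ pointIdeal (K.points i) ^ (2 * j) := by
  have hbary : ∀ l ≠ i, bary K l ∈ pointIdeal (K.points i) := fun l hl => by
    rw [mem_pointIdeal, evalAt_bary_points, if_neg hl]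
  have hbubble : bubble K ∈ pointIdeal (K.points i) ^ 2 := by
    rw [bubble_eq K i, sq]
    exact Ideal.mul_mem_left _ _ (Ideal.mul_mem_mul (hbary _ (by simp)) (hbary _ (by simp)))
  rw [pow_mul]
  exact Ideal.mem_of_dvd _ (mem_bubbleSpace.1 hp).2 (Ideal.pow_mem_pow hbubble j)

theorem evalAt_edge_eq_zero {m : ℕ} {p : Poly} (hp : p ∈ bubbleSpace K 1 m) (i : Fin 3) (t : ℝ) :
    evalAt (edge K i t) p = 0 := by
  obtain ⟨q, rfl⟩ := (mem_bubbleSpace.1 hp).2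
  rw [pow_one, evalAt_mul, evalAt_edge_bubble, zero_mul]

theorem evalAt_eq_zero_of_mem_segment {m : ℕ} {p : Poly} (hp : p ∈ bubbleSpace K 1 m)
    {i j : Fin 3} (hij : i ≠ j) {x : Pt} (hx : x ∈ segment ℝ (K.points i) (K.points j)) :
    evalAt x p = 0 := by
  obtain ⟨q, rfl⟩ := (mem_bubbleSpace.1 hp).2
  rw [pow_one, evalAt_mul, evalAt_bubble_of_mem_segment K hij hx, zero_mul]

end Bubble

section LocalCurl

theorem evalAt_lineMap_eq_of_pd_eq_zero {p : Poly} {A B : Pt}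
    (h : ∀ l, ∀ t ∈ Set.Ioo (0 : ℝ) 1, evalAt (AffineMap.lineMap A B t) (pd l p) = 0) (t : ℝ) :
    evalAt (AffineMap.lineMap A B t) p = evalAt A p := by
  have hderiv : ∀ s, HasDerivAt (fun r => evalAt (AffineMap.lineMap A B r) p) 0 s := fun s => by
    refine (hasDerivAt_evalAt_lineMap p A B s).congr_deriv (Finset.sum_eq_zero fun l _ => ?_)
    rw [evalAt_eq_zero_on_line (h l), mul_zero]
  have hconst := is_const_of_deriv_eq_zero (fun s => (hderiv s).differentiableAt)
    (fun s => (hderiv s).deriv) t 0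
  simpa only [AffineMap.lineMap_apply_zero] using hconst

theorem evalAt_edge_eq_of_pd_eq_zero {K : Tri} {p : Poly}
    (h : ∀ l i, ∀ t ∈ Set.Ioo (0 : ℝ) 1, evalAt (edge K i t) (pd l p) = 0) (i : Fin 3) (t : ℝ) :
    evalAt (edge K i t) p = evalAt (K.points 0) p := by
  have hedge : ∀ i t, evalAt (edge K i t) p = evalAt (K.points (i + 1)) p := fun i =>
    evalAt_lineMap_eq_of_pd_eq_zero fun l => h l i
  have hnext : ∀ i, evalAt (K.points (i + 2)) p = evalAt (K.points (i + 1)) p := fun i => by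
    rw [← hedge i 1, edge, AffineMap.lineMap_apply_one]
  rw [hedge]
  fin_cases i
  exacts [((hnext 1).trans (hnext 0)).symm, (hnext 1).symm, rfl]

theorem exists_curl_eq_of_mem_bubbleSpace {K : Tri} {m : ℕ} {p q : Poly}
    (hp : p ∈ bubbleSpace K 1 m) (hq : q ∈ bubbleSpace K 1 m) (h : pd 0 p + pd 1 q = 0) :
    ∃ φ ∈ bubbleSpace K 2 (m + 1), pd 1 φ = p ∧ pd 0 φ = -q := by
  obtain ⟨φ, hφ, rfl, hφq⟩ :=
    exists_pderiv_eq_of_divergence_eq_zero (mem_bubbleSpace.1 hp).1 (mem_bubbleSpace.1 hq).1 h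
  let ψ : Poly := φ - C (evalAt (K.points 0) φ)
  have hpd : ∀ l, pd l ψ = pd l φ := fun l => by rw [map_sub, pd_C, sub_zero]
  have hzero : ∀ l i, ∀ t ∈ Set.Ioo (0 : ℝ) 1, evalAt (edge K i t) (pd l φ) = 0 := by
    intro l i t _
    fin_cases l
    · exact (congrArg _ hφq).trans (by rw [map_neg, evalAt_edge_eq_zero hq, neg_zero])
    · exact evalAt_edge_eq_zero hp i t
  refine ⟨ψ, mem_bubbleSpace.2 ⟨sub_mem hφ ?_, bubble_sq_dvd K (fun i t _ => ?_) ?_⟩,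
    hpd 1, (hpd 0).trans hφq⟩
  · rw [mem_degreeLT_succ, totalDegree_C]
    exact Nat.zero_le m
  · rw [map_sub, evalAt_C, evalAt_edge_eq_of_pd_eq_zero hzero, sub_self]
  · simpa only [hpd] using hzero

end LocalCurl

section TestFunctions

open Filter Topology

variable {Ω : Opens Pt}

theorem IsTest.cpartial {φ : Pt → ℝ} (hφ : IsTest Ω φ) (i : Fin 2) :
    IsTest Ω (cpartial i φ) := by
  refine ⟨contDiff_cpartial i hφ.smooth, hasCompactSupport_cpartial i hφ.compact, ?_⟩
  have hsupp : Function.support (StokesFE.cpartial i φ) ⊆ Function.support (fderiv ℝ φ) :=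
    fun x hx h => hx (by rw [StokesFE.cpartial, h, zero_apply])
  exact ((closure_mono hsupp).trans (tsupport_fderiv_subset ℝ)).trans hφ.support

theorem IsTest.eq_zero_of_notMem {φ : Pt → ℝ} (hφ : IsTest Ω φ) {x : Pt} (hx : x ∉ Ω) : φ x = 0 :=
  image_eq_zero_of_notMem_tsupport fun h => hx (hφ.support h)

theorem IsTest.memLp {φ : Pt → ℝ} (hφ : IsTest Ω φ) :
    MemLp φ 2 (volume.restrict (Ω : Set Pt)) :=
  hφ.smooth.continuous.memLp_of_hasCompactSupport hφ.compact

theorem integral_mul_cpartial {f φ : Pt → ℝ} (hf : ContDiff ℝ ∞ f) (hφ : IsTest Ω φ) (i : Fin 2) :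
    ∫ x in (Ω : Set Pt), f x * cpartial i φ x = -∫ x in (Ω : Set Pt), cpartial i f x * φ x := by
  have setIntegral_mul_eq (g : Pt → ℝ) {h : Pt → ℝ} (hh : IsTest Ω h) :
      ∫ x in (Ω : Set Pt), g x * h x = ∫ x, g x * h x :=
    setIntegral_eq_integral_of_forall_compl_eq_zero fun x hx => by
      rw [hh.eq_zero_of_notMem hx, mul_zero]
  have integrable_mul {g h : Pt → ℝ} (hg : Continuous g) (hh : IsTest Ω h) :
      Integrable fun x => g x * h x :=
    (hg.mul hh.smooth.continuous).integrable_of_hasCompactSupport hh.compact.mul_left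
  rw [setIntegral_mul_eq _ (hφ.cpartial i), setIntegral_mul_eq _ hφ]
  exact integral_mul_fderiv_eq_neg_fderiv_mul_of_integrable
    (integrable_mul (contDiff_cpartial i hf).continuous hφ)
    (integrable_mul hf.continuous (hφ.cpartial i)) (integrable_mul hf.continuous hφ)
    (fun x _ => (hf.differentiable (by simp)).differentiableAt)
    (fun x _ => (hφ.smooth.differentiable (by simp)).differentiableAt)

theorem integral_cpartial_eq_zero {φ : Pt → ℝ} (hφ : IsTest Ω φ) (i : Fin 2) :
    ∫ x in (Ω : Set Pt), cpartial i φ x = 0 := by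
  simpa [cpartial] using integral_mul_cpartial (f := fun _ => 1) contDiff_const hφ i

theorem continuous_integral_mul {φ : Pt → ℝ} (hφ : MemLp φ 2 (volume.restrict (Ω : Set Pt))) :
    Continuous fun v : L2 Ω => ∫ x in (Ω : Set Pt), v x * φ x := by
  have integral_eq_inner (v : L2 Ω) :
      ∫ x in (Ω : Set Pt), v x * φ x = inner ℝ (hφ.toLp φ) v := by
    rw [L2.inner_def]
    refine integral_congr_ae ?_
    filter_upwards [hφ.coeFn_toLp] with x hx
    simp [hx]
  simp only [integral_eq_inner]
  exact continuous_const.inner continuous_id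

theorem hasWeakPartial_of_mem_closure {z : L2 Ω × (Fin 2 → L2 Ω)}
    (hz : z ∈ closure (testJet1 Ω : Set (L2 Ω × (Fin 2 → L2 Ω)))) (i : Fin 2) :
    HasWeakPartial Ω i z.1 (z.2 i) := by
  intro φ hφ
  have hclosed : IsClosed {z : L2 Ω × (Fin 2 → L2 Ω) |
      ∫ x in (Ω : Set Pt), z.1 x * cpartial i φ x = -∫ x in (Ω : Set Pt), z.2 i x * φ x} :=
    isClosed_eq ((continuous_integral_mul (hφ.cpartial i).memLp).comp continuous_fst)
      ((continuous_integral_mul hφ.memLp).comp ((continuous_apply i).comp continuous_snd)).neg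
  refine closure_minimal ?_ hclosed hz
  rintro z ⟨ψ, hψ, hz0, hz1⟩
  calc ∫ x in (Ω : Set Pt), z.1 x * cpartial i φ x
      = ∫ x in (Ω : Set Pt), ψ x * cpartial i φ x :=
        integral_congr_ae (hz0.mono fun x hx => by simp only [hx])
    _ = -∫ x in (Ω : Set Pt), cpartial i ψ x * φ x := integral_mul_cpartial hψ.smooth hφ i
    _ = -∫ x in (Ω : Set Pt), z.2 i x * φ x :=
        congrArg Neg.neg (integral_congr_ae ((hz1 i).mono fun x hx => by simp only [hx]))

theorem wpartial_of_mem_closure {z : L2 Ω × (Fin 2 → L2 Ω)}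
    (hz : z ∈ closure (testJet1 Ω : Set (L2 Ω × (Fin 2 → L2 Ω)))) (i : Fin 2) :
    wpartial i z.1 = z.2 i :=
  (hasWeakPartial_of_mem_closure hz i).wpartial_eq

theorem mem_H10_of_mem_closure {z : L2 Ω × (Fin 2 → L2 Ω)}
    (hz : z ∈ closure (testJet1 Ω : Set (L2 Ω × (Fin 2 → L2 Ω)))) : z.1 ∈ H10 Ω := by
  refine ⟨fun i => ⟨_, hasWeakPartial_of_mem_closure hz i⟩, ?_⟩
  simp only [wpartial_of_mem_closure hz]
  exact hz

theorem jet_mem_closure_testJet1 {z : L2 Ω × (Fin 2 → L2 Ω) × (Fin 2 → Fin 2 → L2 Ω)}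
    (hz : z ∈ closure (testJet2 Ω : Set (L2 Ω × (Fin 2 → L2 Ω) × (Fin 2 → Fin 2 → L2 Ω)))) :
    (z.1, z.2.1) ∈ closure (testJet1 Ω : Set (L2 Ω × (Fin 2 → L2 Ω))) := by
  refine map_mem_closure (f := fun z : L2 Ω × (Fin 2 → L2 Ω) × (Fin 2 → Fin 2 → L2 Ω) =>
    (z.1, z.2.1)) (by fun_prop) hz ?_
  rintro y ⟨φ, hφ, h0, h1, -⟩
  exact ⟨φ, hφ, h0, h1⟩

theorem partial_jet_mem_closure_testJet1 {z : L2 Ω × (Fin 2 → L2 Ω) × (Fin 2 → Fin 2 → L2 Ω)}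
    (hz : z ∈ closure (testJet2 Ω : Set (L2 Ω × (Fin 2 → L2 Ω) × (Fin 2 → Fin 2 → L2 Ω))))
    (j : Fin 2) :
    (z.2.1 j, fun i => z.2.2 i j) ∈ closure (testJet1 Ω : Set (L2 Ω × (Fin 2 → L2 Ω))) := by
  refine map_mem_closure (f := fun z : L2 Ω × (Fin 2 → L2 Ω) × (Fin 2 → Fin 2 → L2 Ω) =>
    (z.2.1 j, fun i => z.2.2 i j)) (by fun_prop) hz ?_
  rintro y ⟨φ, hφ, -, h1, h2⟩
  exact ⟨cpartial j φ, hφ.cpartial j, h1 j, fun i => h2 i j⟩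

theorem mem_H20_of_mem_closure {z : L2 Ω × (Fin 2 → L2 Ω) × (Fin 2 → Fin 2 → L2 Ω)}
    (hz : z ∈ closure (testJet2 Ω : Set (L2 Ω × (Fin 2 → L2 Ω) × (Fin 2 → Fin 2 → L2 Ω)))) :
    z.1 ∈ H20 Ω := by
  have hz0 := jet_mem_closure_testJet1 hz
  have hz1 := partial_jet_mem_closure_testJet1 hz
  refine ⟨⟨(mem_H10_of_mem_closure hz0).1, fun j => ?_⟩, ?_⟩
  · rw [wpartial_of_mem_closure hz0]
    exact (mem_H10_of_mem_closure (hz1 j)).1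
  · simp only [wpartial_of_mem_closure hz0, fun i j => wpartial_of_mem_closure (hz1 j) i]
    exact hz

theorem integral_wpartial_eq_zero [IsFiniteMeasure (volume.restrict (Ω : Set Pt))]
    {v : L2 Ω} (hv : v ∈ H10 Ω) (i : Fin 2) : ∫ x in (Ω : Set Pt), wpartial i v x = 0 := by
  have hclosed : IsClosed {z : L2 Ω × (Fin 2 → L2 Ω) | ∫ x in (Ω : Set Pt), z.2 i x * 1 = 0} :=
    isClosed_eq ((continuous_integral_mul (φ := fun _ => 1) (memLp_const 1)).comp
      ((continuous_apply i).comp continuous_snd)) continuous_const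
  have hmem : (v, fun i => wpartial i v) ∈
      {z : L2 Ω × (Fin 2 → L2 Ω) | ∫ x in (Ω : Set Pt), z.2 i x * 1 = 0} := by
    refine closure_minimal ?_ hclosed hv.2
    rintro z ⟨ψ, hψ, -, hz1⟩
    rw [Set.mem_ofPred_eq, ← integral_cpartial_eq_zero hψ i]
    exact integral_congr_ae ((hz1 i).mono fun x hx => by simp only [hx, mul_one])
  simpa only [Set.mem_ofPred_eq, mul_one] using hmem

end TestFunctions

section BoundedConvergence

open Filter Topology

theorem tendsto_Lp_of_forall_norm_le {α E : Type*} [MeasurableSpace α] {μ : Measure α}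
    [IsFiniteMeasure μ] [NormedAddCommGroup E] {p : ENNReal} [hp : Fact (1 ≤ p)] (hp' : p ≠ ⊤)
    {f : ℕ → Lp E p μ} {f₀ : Lp E p μ} {M : ℝ} (hM : ∀ n, ∀ᵐ x ∂μ, ‖f n x‖ ≤ M)
    (hlim : ∀ᵐ x ∂μ, Tendsto (fun n => f n x) atTop (𝓝 (f₀ x))) : Tendsto f atTop (𝓝 f₀) := by
  have hmeas (n : ℕ) : AEStronglyMeasurable (f n) μ := Lp.aestronglyMeasurable _
  rw [Lp.tendsto_Lp_iff_tendsto_eLpNorm']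
  refine tendsto_Lp_finite_of_tendsto_ae hp.out hp' hmeas (Lp.memLp f₀)
    (unifIntegrable_of hp.out hp' hmeas fun ε _ => ⟨(M + 1).toNNReal, fun n => ?_⟩) hlim
  refine (eLpNorm_congr_ae (g := 0) ?_).trans_le (by simp)
  filter_upwards [hM n] with x hx
  refine Set.indicator_of_notMem (fun hx' => ?_) _
  have : M + 1 ≤ ‖f n x‖ := (Real.toNNReal_le_iff_le_coe).1 hx'
  linarith

/-- Uniformly bounded pointwise convergence. -/
structure BddTendsto (F : ℕ → Pt → ℝ) (F₀ : Pt → ℝ) : Prop where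
  bdd : ∃ M, ∀ n x, |F n x| ≤ M
  tendsto : ∀ x, Tendsto (fun n => F n x) atTop (𝓝 (F₀ x))

theorem BddTendsto.add {F G : ℕ → Pt → ℝ} {F₀ G₀ : Pt → ℝ} (hF : BddTendsto F F₀)
    (hG : BddTendsto G G₀) : BddTendsto (fun n => F n + G n) (F₀ + G₀) := by
  obtain ⟨M, hM⟩ := hF.bdd
  obtain ⟨N, hN⟩ := hG.bdd
  exact ⟨⟨M + N, fun n x => (abs_add_le _ _).trans (add_le_add (hM n x) (hN n x))⟩,
    fun x => (hF.tendsto x).add (hG.tendsto x)⟩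

variable {Ω : Opens Pt} [IsFiniteMeasure (volume.restrict (Ω : Set Pt))]

theorem BddTendsto.tendsto_L2 {F : ℕ → Pt → ℝ} {F₀ : Pt → ℝ} (h : BddTendsto F F₀)
    {f : ℕ → L2 Ω} {f₀ : L2 Ω} (hf : ∀ n, f n =ᵐ[volume.restrict (Ω : Set Pt)] F n)
    (hf₀ : f₀ =ᵐ[volume.restrict (Ω : Set Pt)] F₀) : Tendsto f atTop (𝓝 f₀) := by
  obtain ⟨M, hM⟩ := h.bdd
  refine tendsto_Lp_of_forall_norm_le (by simp) (fun n => (hf n).mono fun x hx => ?_) ?_ (M := M)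
  · rw [hx]
    exact hM n x
  · filter_upwards [ae_all_iff.2 hf, hf₀] with x hx hx₀
    simp only [hx, hx₀]
    exact h.tendsto x

theorem mem_closure_testJet1 {φ : ℕ → Pt → ℝ} (hφ : ∀ n, IsTest Ω (φ n)) {F : Pt → ℝ}
    {G : Fin 2 → Pt → ℝ} (h0 : BddTendsto φ F)
    (h1 : ∀ i, BddTendsto (fun n => cpartial i (φ n)) (G i))
    {z : L2 Ω × (Fin 2 → L2 Ω)} (hz0 : z.1 =ᵐ[volume.restrict (Ω : Set Pt)] F)
    (hz1 : ∀ i, z.2 i =ᵐ[volume.restrict (Ω : Set Pt)] G i) :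
    z ∈ closure (testJet1 Ω : Set (L2 Ω × (Fin 2 → L2 Ω))) := by
  refine mem_closure_of_tendsto (b := atTop)
    (f := fun n => ((hφ n).memLp.toLp _, fun i => ((hφ n).cpartial i).memLp.toLp _)) ?_
    (Eventually.of_forall fun n => ⟨φ n, hφ n, (hφ n).memLp.coeFn_toLp,
      fun i => ((hφ n).cpartial i).memLp.coeFn_toLp⟩)
  refine Tendsto.prodMk_nhds (x := z.1) (y := z.2) ?_ (tendsto_pi_nhds.2 fun i => ?_)
  · exact h0.tendsto_L2 (fun n => MemLp.coeFn_toLp _) hz0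
  · exact (h1 i).tendsto_L2 (fun n => MemLp.coeFn_toLp _) (hz1 i)

theorem mem_closure_testJet2 {φ : ℕ → Pt → ℝ} (hφ : ∀ n, IsTest Ω (φ n)) {F : Pt → ℝ}
    {G : Fin 2 → Pt → ℝ} {H : Fin 2 → Fin 2 → Pt → ℝ} (h0 : BddTendsto φ F)
    (h1 : ∀ i, BddTendsto (fun n => cpartial i (φ n)) (G i))
    (h2 : ∀ i j, BddTendsto (fun n => cpartial i (cpartial j (φ n))) (H i j))
    {z : L2 Ω × (Fin 2 → L2 Ω) × (Fin 2 → Fin 2 → L2 Ω)}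
    (hz0 : z.1 =ᵐ[volume.restrict (Ω : Set Pt)] F)
    (hz1 : ∀ i, z.2.1 i =ᵐ[volume.restrict (Ω : Set Pt)] G i)
    (hz2 : ∀ i j, z.2.2 i j =ᵐ[volume.restrict (Ω : Set Pt)] H i j) :
    z ∈ closure (testJet2 Ω : Set (L2 Ω × (Fin 2 → L2 Ω) × (Fin 2 → Fin 2 → L2 Ω))) := by
  refine mem_closure_of_tendsto (b := atTop)
    (f := fun n => ((hφ n).memLp.toLp _, (fun i => ((hφ n).cpartial i).memLp.toLp _),
      fun i j => (((hφ n).cpartial j).cpartial i).memLp.toLp _)) ?_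
    (Eventually.of_forall fun n => ⟨φ n, hφ n, (hφ n).memLp.coeFn_toLp,
      fun i => ((hφ n).cpartial i).memLp.coeFn_toLp,
      fun i j => (((hφ n).cpartial j).cpartial i).memLp.coeFn_toLp⟩)
  refine Tendsto.prodMk_nhds (x := z.1) (y := z.2) ?_
    (Tendsto.prodMk_nhds (x := z.2.1) (y := z.2.2) (tendsto_pi_nhds.2 fun i => ?_)
      (tendsto_pi_nhds.2 fun i => tendsto_pi_nhds.2 fun j => ?_))
  · exact h0.tendsto_L2 (fun n => MemLp.coeFn_toLp _) hz0
  · exact (h1 i).tendsto_L2 (fun n => MemLp.coeFn_toLp _) (hz1 i)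
  · exact (h2 i j).tendsto_L2 (fun n => MemLp.coeFn_toLp _) (hz2 i j)

end BoundedConvergence

section Cutoff

open Filter Topology

/-- Smooth functions on the line that vanish on `(-∞, 1)` and equal `c` on `(2, ∞)`. -/
structure IsCutoff (c : ℝ) (η : ℝ → ℝ) : Prop where
  smooth : ContDiff ℝ ∞ η
  eq_zero : ∀ s < 1, η s = 0
  eq_const : ∀ s > 2, η s = c

theorem exists_isCutoff : ∃ η, IsCutoff 1 η :=
  ⟨fun s => Real.smoothTransition (s - 1),
    (Real.smoothTransition.contDiff (n := ⊤)).comp (contDiff_id.sub contDiff_const),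
    fun s hs => Real.smoothTransition.zero_of_nonpos (by linarith),
    fun s hs => Real.smoothTransition.one_of_one_le (by linarith)⟩

variable {c : ℝ} {η : ℝ → ℝ}

theorem IsCutoff.mul_deriv (h : IsCutoff c η) : IsCutoff 0 (fun s => s * deriv η s) := by
  refine ⟨contDiff_id.mul (contDiff_infty_iff_deriv.1 h.smooth).2, fun s hs => ?_, fun s hs => ?_⟩
  · have : η =ᶠ[𝓝 s] fun _ => 0 := eventually_of_mem (Iio_mem_nhds hs) h.eq_zero
    rw [this.deriv_eq, deriv_const, mul_zero]
  · have : η =ᶠ[𝓝 s] fun _ => c := eventually_of_mem (Ioi_mem_nhds hs) h.eq_const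
    rw [this.deriv_eq, deriv_const, mul_zero]

theorem IsCutoff.bdd (h : IsCutoff c η) : ∃ M, ∀ s, |η s| ≤ M := by
  obtain ⟨M, hM⟩ := (isCompact_Icc (a := (1 : ℝ)) (b := 2)).exists_bound_of_continuousOn
    h.smooth.continuous.continuousOn
  refine ⟨max M |c|, fun s => ?_⟩
  rcases lt_or_ge s 1 with h1 | h1
  · rw [h.eq_zero s h1, abs_zero]
    exact le_max_of_le_right (abs_nonneg c)
  · rcases lt_or_ge 2 s with h2 | h2
    · rw [h.eq_const s h2]
      exact le_max_right _ _
    · exact le_max_of_le_left (hM s ⟨h1, h2⟩)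

/-- The function that is `p` in the interior of `K` and zero elsewhere. -/
def zeroExtend (K : Tri) : Poly →ₗ[ℝ] Pt → ℝ where
  toFun p := K.interior.indicator fun x => evalAt x p
  map_add' p q := by simp only [map_add, ← Set.indicator_add']; rfl
  map_smul' c p := by
    simp only [map_smul, RingHom.id_apply]
    exact Set.indicator_const_smul _ c _

variable (K : Tri)

theorem zeroExtend_of_mem {x : Pt} (hx : x ∈ K.interior) (p : Poly) :
    zeroExtend K p x = evalAt x p :=
  Set.indicator_of_mem hx fun x => evalAt x p

theorem zeroExtend_of_notMem {x : Pt} (hx : x ∉ K.interior) (p : Poly) : zeroExtend K p x = 0 :=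
  Set.indicator_of_notMem hx fun x => evalAt x p

theorem exists_abs_zeroExtend_le (p : Poly) : ∃ M, ∀ x, |zeroExtend K p x| ≤ M := by
  obtain ⟨M, hM⟩ := K.isCompact_closedInterior.exists_bound_of_continuousOn
    (continuous_evalAt p).continuousOn
  refine ⟨M, fun x => ?_⟩
  by_cases hx : x ∈ K.interior
  · rw [zeroExtend_of_mem K hx]
    exact hM x (K.interior_subset_closedInterior hx)
  · rw [zeroExtend_of_notMem K hx, abs_zero]
    exact (norm_nonneg _).trans (hM _ (K.point_mem_closedInterior 0))

/-- The polynomial `r` on `K`, cut off near the boundary, and zero outside `K`. -/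
def cut (η : ℝ → ℝ) (N : ℝ) (r : Poly) (x : Pt) : ℝ :=
  η (N * evalAt x (bubble K)) * zeroExtend K r x

/-- The part of a triangle away from its boundary that contains the support of `cut K η N r`. -/
def cutSet (N : ℝ) : Set Pt :=
  K.closedInterior ∩ {x | 1 ≤ N * evalAt x (bubble K)}

theorem isCompact_cutSet (N : ℝ) : IsCompact (cutSet K N) :=
  K.isCompact_closedInterior.inter_right
    (isClosed_le continuous_const (continuous_const.mul (continuous_evalAt _)))

theorem cutSet_subset_interior {N : ℝ} (hN : 0 < N) : cutSet K N ⊆ K.interior := fun _ hx =>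
  mem_interior_of_bubble_pos K hx.1
    ((pos_iff_pos_of_mul_pos (zero_lt_one.trans_le hx.2)).1 hN)

variable {K}

theorem cut_of_notMem_cutSet (hη : IsCutoff c η) {N : ℝ} (r : Poly) {x : Pt}
    (hx : x ∉ cutSet K N) : cut K η N r x = 0 := by
  by_cases hxK : x ∈ K.interior
  · rw [cut, hη.eq_zero, zero_mul]
    by_contra! h
    exact hx ⟨K.interior_subset_closedInterior hxK, h⟩
  · rw [cut, zeroExtend_of_notMem K hxK, mul_zero]

theorem cut_eventuallyEq (η : ℝ → ℝ) (N : ℝ) (r : Poly) {x : Pt} (hx : x ∈ K.interior) :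
    cut K η N r =ᶠ[𝓝 x] fun x => η (N * evalAt x (bubble K)) * evalAt x r := by
  filter_upwards [(isOpen_interior K).mem_nhds hx] with y hy
  rw [cut, zeroExtend_of_mem K hy]

theorem cut_eventuallyEq_zero (hη : IsCutoff c η) {N : ℝ} (hN : 0 < N) (r : Poly) {x : Pt}
    (hx : x ∉ K.interior) : cut K η N r =ᶠ[𝓝 x] fun _ => 0 := by
  filter_upwards [(isCompact_cutSet K N).isClosed.isOpen_compl.mem_nhds
    fun h => hx (cutSet_subset_interior K hN h)] with y hy
  exact cut_of_notMem_cutSet hη r hy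

theorem isTest_cut {Ω : Opens Pt} (hK : K.interior ⊆ (Ω : Set Pt)) (hη : IsCutoff c η) {N : ℝ}
    (hN : 0 < N) (r : Poly) : IsTest Ω (cut K η N r) := by
  have hsupp : tsupport (cut K η N r) ⊆ cutSet K N := by
    refine closure_minimal (fun x hx => ?_) (isCompact_cutSet K N).isClosed
    by_contra h
    exact hx (cut_of_notMem_cutSet hη r h)
  refine ⟨contDiff_iff_contDiffAt.2 fun x => ?_,
    (isCompact_cutSet K N).of_isClosed_subset (isClosed_tsupport _) hsupp,
    (hsupp.trans (cutSet_subset_interior K hN)).trans hK⟩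
  by_cases hx : x ∈ K.interior
  · have hsmooth : ContDiff ℝ ∞ fun x => η (N * evalAt x (bubble K)) * evalAt x r :=
      (hη.smooth.comp (contDiff_const.mul (contDiff_evalAt _))).mul (contDiff_evalAt r)
    exact hsmooth.contDiffAt.congr_of_eventuallyEq (cut_eventuallyEq η N r hx)
  · exact contDiffAt_const.congr_of_eventuallyEq (cut_eventuallyEq_zero hη hN r hx)

/- The factor `N` produced by differentiating `η (N b)` is absorbed by the factor `b` of the
polynomial, so the derivative is again a sum of cut-off polynomials. -/
theorem cpartial_cut (hη : IsCutoff c η) {N : ℝ} (hN : 0 < N) (i : Fin 2) (r : Poly) :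
    cpartial i (cut K η N (bubble K * r)) =
      cut K (fun s => s * deriv η s) N (pd i (bubble K) * r) +
        cut K η N (pd i (bubble K * r)) := by
  funext x
  by_cases hx : x ∈ K.interior
  · have hη' : HasDerivAt η (deriv η (N * evalAt x (bubble K))) (N * evalAt x (bubble K)) :=
      ((hη.smooth.differentiable (by simp)).differentiableAt).hasDerivAt
    have hcut := ((hη'.comp_hasFDerivAt x ((hasFDerivAt_evalAt (bubble K) x).const_mul N)).mul
      (hasFDerivAt_evalAt (bubble K * r) x)).congr_of_eventuallyEq (cut_eventuallyEq η N _ hx)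
    rw [Pi.add_apply, cpartial, hcut.fderiv, cut, cut, zeroExtend_of_mem K hx,
      zeroExtend_of_mem K hx]
    fin_cases i <;> simp [Fin.sum_univ_two, evalAt_mul] <;> ring
  · rw [Pi.add_apply, cpartial, (cut_eventuallyEq_zero hη hN _ hx).fderiv_eq, cut, cut,
      zeroExtend_of_notMem K hx, zeroExtend_of_notMem K hx]
    simp

theorem bddTendsto_cut (hη : IsCutoff c η) (r : Poly) :
    BddTendsto (fun n : ℕ => cut K η (n + 1) r) (zeroExtend K (c • r)) where
  bdd := by
    obtain ⟨M, hM⟩ := hη.bdd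
    obtain ⟨M', hM'⟩ := exists_abs_zeroExtend_le K r
    refine ⟨M * M', fun n x => ?_⟩
    rw [cut, abs_mul]
    exact mul_le_mul (hM _) (hM' x) (abs_nonneg _) ((abs_nonneg _).trans (hM 0))
  tendsto x := by
    rw [map_smul, Pi.smul_apply, smul_eq_mul]
    by_cases hx : x ∈ K.interior
    · have ht : Tendsto (fun n : ℕ => ((n : ℝ) + 1) * evalAt x (bubble K)) atTop atTop :=
        (tendsto_atTop_add_const_right _ 1 tendsto_natCast_atTop_atTop).atTop_mul_const
          (evalAt_bubble_pos K hx)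
      refine tendsto_const_nhds.congr' ?_
      filter_upwards [ht.eventually_gt_atTop 2] with n hn
      rw [cut, hη.eq_const _ hn]
    · simp only [cut, zeroExtend_of_notMem K hx, mul_zero]
      exact tendsto_const_nhds

theorem bddTendsto_cpartial_cut (hη : IsCutoff c η) (i : Fin 2) {p : Poly} (hp : bubble K ∣ p) :
    BddTendsto (fun n : ℕ => cpartial i (cut K η (n + 1) p)) (zeroExtend K (c • pd i p)) := by
  obtain ⟨r, rfl⟩ := hp
  simpa only [cpartial_cut hη (Nat.cast_add_one_pos _), zero_smul, map_zero, zero_add] using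
    (bddTendsto_cut hη.mul_deriv _).add (bddTendsto_cut hη _)

theorem bddTendsto_cpartial_cpartial_cut (hη : IsCutoff c η) (i j : Fin 2) {p : Poly}
    (hp : bubble K ^ 2 ∣ p) :
    BddTendsto (fun n : ℕ => cpartial i (cpartial j (cut K η (n + 1) p)))
      (zeroExtend K (c • pd i (pd j p))) := by
  obtain ⟨r, rfl⟩ := hp
  rw [sq, mul_assoc]
  have hsmooth {c : ℝ} {η : ℝ → ℝ} (hη : IsCutoff c η) (n : ℕ) (s : Poly) :
      ContDiff ℝ ∞ (cut K η (n + 1) s) :=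
    (isTest_cut (Ω := ⊤) (Set.subset_univ _) hη (Nat.cast_add_one_pos _) s).smooth
  have hdvd : bubble K ∣ pd j (bubble K * (bubble K * r)) := by
    rw [pd_mul]
    exact dvd_add (dvd_mul_of_dvd_right (dvd_mul_right _ _) _) (dvd_mul_right _ _)
  simpa only [cpartial_cut hη (Nat.cast_add_one_pos _),
    cpartial_add i (hsmooth hη.mul_deriv _ _) (hsmooth hη _ _), zero_smul, map_zero, zero_add] using
    (bddTendsto_cpartial_cut hη.mul_deriv i
      (dvd_mul_of_dvd_right (dvd_mul_right (bubble K) r) (pd j (bubble K)))).add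
    (bddTendsto_cpartial_cut hη i hdvd)

end Cutoff

section PieceL2

variable (Ω : Opens Pt) (K : Tri)

theorem isFiniteMeasure_restrict_interior (μ : Measure Pt) [IsFiniteMeasureOnCompacts μ] :
    IsFiniteMeasure (μ.restrict K.interior) :=
  isFiniteMeasure_restrict.2 ((measure_mono K.interior_subset_closedInterior).trans_lt
    K.isCompact_closedInterior.measure_lt_top).ne

theorem memLp_zeroExtend (p : Poly) : MemLp (zeroExtend K p) 2 (volume.restrict (Ω : Set Pt)) := by
  obtain ⟨M, hM⟩ := K.isCompact_closedInterior.exists_bound_of_continuousOn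
    (continuous_evalAt p).continuousOn
  have hmeas : MeasurableSet K.interior := (isOpen_interior K).measurableSet
  refine MemLp.restrict _ ((memLp_indicator_iff_restrict hmeas).2 ?_)
  have := isFiniteMeasure_restrict_interior K volume
  refine MemLp.of_bound (continuous_evalAt p).aestronglyMeasurable M ?_
  filter_upwards [ae_restrict_mem hmeas] with x hx
  exact hM x (K.interior_subset_closedInterior hx)

/-- `zeroExtend` as a map into `L²(Ω)`. -/
def pieceL2 : Poly →ₗ[ℝ] L2 Ω where
  toFun p := (memLp_zeroExtend Ω K p).toLp _
  map_add' p q := by simp only [map_add, MemLp.toLp_add (memLp_zeroExtend Ω K p)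
    (memLp_zeroExtend Ω K q)]
  map_smul' c p := by simp only [map_smul, RingHom.id_apply,
    MemLp.toLp_const_smul c (memLp_zeroExtend Ω K p)]

theorem coeFn_pieceL2 (p : Poly) :
    pieceL2 Ω K p =ᵐ[volume.restrict (Ω : Set Pt)] zeroExtend K p :=
  (memLp_zeroExtend Ω K p).coeFn_toLp

variable {Ω K} [IsFiniteMeasure (volume.restrict (Ω : Set Pt))] {p : Poly}

theorem pieceL2_mem_closure_testJet1 (hK : K.interior ⊆ (Ω : Set Pt)) (hp : bubble K ∣ p) :
    (pieceL2 Ω K p, fun i => pieceL2 Ω K (pd i p)) ∈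
      closure (testJet1 Ω : Set (L2 Ω × (Fin 2 → L2 Ω))) := by
  obtain ⟨η, hη⟩ := exists_isCutoff
  refine mem_closure_testJet1 (fun n => isTest_cut hK hη (Nat.cast_add_one_pos n) p)
    (bddTendsto_cut hη p) (fun i => bddTendsto_cpartial_cut hη i hp) ?_ fun i => ?_ <;>
  simpa only [one_smul] using coeFn_pieceL2 Ω K _

theorem pieceL2_mem_H10 (hK : K.interior ⊆ (Ω : Set Pt)) (hp : bubble K ∣ p) :
    pieceL2 Ω K p ∈ H10 Ω :=
  mem_H10_of_mem_closure (pieceL2_mem_closure_testJet1 hK hp)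

theorem wpartial_pieceL2 (hK : K.interior ⊆ (Ω : Set Pt)) (hp : bubble K ∣ p) (i : Fin 2) :
    wpartial i (pieceL2 Ω K p) = pieceL2 Ω K (pd i p) :=
  wpartial_of_mem_closure (pieceL2_mem_closure_testJet1 hK hp) i

theorem pieceL2_mem_H20 (hK : K.interior ⊆ (Ω : Set Pt)) (hp : bubble K ^ 2 ∣ p) :
    pieceL2 Ω K p ∈ H20 Ω := by
  obtain ⟨η, hη⟩ := exists_isCutoff
  have hp1 : bubble K ∣ p := (dvd_pow_self _ two_ne_zero).trans hp
  refine mem_H20_of_mem_closure (z := (pieceL2 Ω K p, (fun i => pieceL2 Ω K (pd i p)),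
    fun i j => pieceL2 Ω K (pd i (pd j p)))) ?_
  refine mem_closure_testJet2 (fun n => isTest_cut hK hη (Nat.cast_add_one_pos n) p)
    (bddTendsto_cut hη p) (fun i => bddTendsto_cpartial_cut hη i hp1)
    (fun i j => bddTendsto_cpartial_cpartial_cut hη i j hp) ?_ (fun i => ?_) fun i j => ?_ <;>
  simpa only [one_smul] using coeFn_pieceL2 Ω K _

end PieceL2

section IntegralTri

/-- The integral of a polynomial over a triangle. -/
def integralTri (K : Tri) : Poly →ₗ[ℝ] ℝ where
  toFun p := ∫ x in K.closedInterior, evalAt x p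
  map_add' p q := by
    simp only [map_add]
    exact integral_add
      ((continuous_evalAt p).continuousOn.integrableOn_compact K.isCompact_closedInterior)
      ((continuous_evalAt q).continuousOn.integrableOn_compact K.isCompact_closedInterior)
  map_smul' c p := by
    simp only [map_smul, RingHom.id_apply]
    exact integral_smul _ _

variable (K : Tri)

theorem integralTri_eq_setIntegral_interior (p : Poly) :
    integralTri K p = ∫ x in K.interior, evalAt x p :=
  (setIntegral_congr_set (interior_ae_eq_closedInterior K)).symm

theorem integralTri_pd_eq_zero (l : Fin 2) {p : Poly} (hp : bubble K ∣ p) :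
    integralTri K (pd l p) = 0 := by
  let Ω : Opens Pt := ⟨K.interior, isOpen_interior K⟩
  have hfin : IsFiniteMeasure (volume.restrict (Ω : Set Pt)) :=
    isFiniteMeasure_restrict_interior K volume
  have hK : K.interior ⊆ (Ω : Set Pt) := subset_rfl
  calc integralTri K (pd l p)
      = ∫ x in (Ω : Set Pt), zeroExtend K (pd l p) x := by
        rw [integralTri_eq_setIntegral_interior]
        exact setIntegral_congr_fun (isOpen_interior K).measurableSet
          fun x hx => (zeroExtend_of_mem K hx _).symm
    _ = ∫ x in (Ω : Set Pt), wpartial l (pieceL2 Ω K p) x := by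
        rw [wpartial_pieceL2 hK hp]
        exact integral_congr_ae (coeFn_pieceL2 Ω K _).symm
    _ = 0 := integral_wpartial_eq_zero (pieceL2_mem_H10 hK hp) l

theorem integralTri_bary_mul_bary_pos : 0 < integralTri K (bary K 0 * bary K 1) := by
  have hpos : ∀ x ∈ K.interior, 0 < evalAt x (bary K 0 * bary K 1) := fun x hx => by
    rw [interior_eq] at hx
    rw [evalAt_mul]
    exact mul_pos (hx 0) (hx 1)
  have hopen := isOpen_interior K
  rw [integralTri_eq_setIntegral_interior, setIntegral_pos_iff_support_of_nonneg_ae]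
  · exact (hopen.measure_pos volume (interior_nonempty K)).trans_le
      (measure_mono fun x hx => ⟨(hpos x hx).ne', hx⟩)
  · filter_upwards [ae_restrict_mem hopen.measurableSet] with x hx using (hpos x hx).le
  · exact ((continuous_evalAt _).continuousOn.integrableOn_compact
      K.isCompact_closedInterior).mono_set K.interior_subset_closedInterior

end IntegralTri

section LocalDivergence

theorem finrank_map_add_finrank_inf_ker {𝕜 V W : Type*} [DivisionRing 𝕜] [AddCommGroup V]
    [Module 𝕜 V] [AddCommGroup W] [Module 𝕜 W] (f : V →ₗ[𝕜] W) (S : Submodule 𝕜 V)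
    [Module.Finite 𝕜 S] :
    Module.finrank 𝕜 (S.map f) + Module.finrank 𝕜 (S ⊓ LinearMap.ker f : Submodule 𝕜 V) =
      Module.finrank 𝕜 S := by
  rw [← LinearMap.finrank_range_add_finrank_ker (f.domRestrict S), LinearMap.range_domRestrict,
    LinearMap.ker_domRestrict, ← Submodule.finrank_map_subtype_eq, Submodule.map_comap_subtype]

theorem finrank_submodule_prod {𝕜 V W : Type*} [DivisionRing 𝕜] [AddCommGroup V] [Module 𝕜 V]
    [AddCommGroup W] [Module 𝕜 W] (S : Submodule 𝕜 V) (T : Submodule 𝕜 W) [Module.Finite 𝕜 S]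
    [Module.Finite 𝕜 T] :
    Module.finrank 𝕜 (S.prod T) = Module.finrank 𝕜 S + Module.finrank 𝕜 T := by
  have hinj : Function.Injective (S.subtype.prodMap T.subtype) :=
    Function.Injective.prodMap Subtype.val_injective Subtype.val_injective
  rw [← Module.finrank_prod, ← LinearMap.finrank_range_of_inj hinj, LinearMap.range_prodMap,
    Submodule.range_subtype, Submodule.range_subtype]

/-- The divergence of a polynomial vector field. -/
def polyDiv : Poly × Poly →ₗ[ℝ] Poly :=
  (pd 0).coprod (pd 1)

/-- The vector field `(∂_y p, -∂_x p)` of a polynomial. -/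
def polyCurl : Poly →ₗ[ℝ] Poly × Poly :=
  (pd 1).prod (-pd 0)

/-- The values of a polynomial at the vertices of a triangle. -/
def vertexValues (K : Tri) : Poly →ₗ[ℝ] Fin 3 → ℝ :=
  LinearMap.pi fun i => evalAt (K.points i)

variable (K : Tri)

theorem prod_bubbleSpace_inf_ker_polyDiv_le (m : ℕ) :
    (bubbleSpace K 1 m).prod (bubbleSpace K 1 m) ⊓ LinearMap.ker polyDiv ≤
      (bubbleSpace K 2 (m + 1)).map polyCurl := by
  rintro ⟨p, q⟩ ⟨⟨hp, hq⟩, hdiv⟩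
  obtain ⟨φ, hφ, hφp, hφq⟩ := exists_curl_eq_of_mem_bubbleSpace hp hq hdiv
  exact ⟨φ, hφ, Prod.ext hφp (neg_eq_iff_eq_neg.2 hφq)⟩

theorem map_polyDiv_prod_bubbleSpace_le (k : ℕ) :
    ((bubbleSpace K 1 (k + 1)).prod (bubbleSpace K 1 (k + 1))).map polyDiv ≤
      degreeLT (Fin 2) ℝ k ⊓ LinearMap.ker ((vertexValues K).prod (integralTri K)) := by
  have hpd : ∀ p ∈ bubbleSpace K 1 (k + 1), ∀ l, pd l p ∈
      degreeLT (Fin 2) ℝ k ⊓ LinearMap.ker ((vertexValues K).prod (integralTri K)) := by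
    intro p hp l
    refine ⟨pderiv_mem_degreeLT l (mem_bubbleSpace.1 hp).1, Prod.ext (funext fun i => ?_) ?_⟩
    · have h := derivation_mem_pow (pderiv l) _ 1 (mem_pointIdeal_of_mem_bubbleSpace hp i)
      rwa [pow_one] at h
    · exact integralTri_pd_eq_zero K l (by simpa only [pow_one] using (mem_bubbleSpace.1 hp).2)
  rintro _ ⟨⟨p, q⟩, ⟨hp, hq⟩, rfl⟩
  exact add_mem (hpd p hp 0) (hpd q hq 1)

theorem bary_mem_degreeLT_two (i : Fin 3) : bary K i ∈ degreeLT (Fin 2) ℝ 2 :=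
  mem_degreeLT_succ.2 (totalDegree_bary K i).le

theorem map_vertexValues_degreeLT_two :
    (degreeLT (Fin 2) ℝ 2).map (vertexValues K) = ⊤ := by
  refine eq_top_iff.2 fun v _ => ⟨∑ i, v i • bary K i,
    sum_mem fun i _ => Submodule.smul_mem _ _ (bary_mem_degreeLT_two K i), funext fun j => ?_⟩
  change evalAt (K.points j) (∑ i, v i • bary K i) = v j
  simp [evalAt_bary_points]

theorem degreeLT_two_inf_ker_vertexValues :
    degreeLT (Fin 2) ℝ 2 ⊓ LinearMap.ker (vertexValues K) = ⊥ := by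
  have hdeg := two_mul_finrank_degreeLT_fin_two (R := ℝ) 2
  have hdim : 3 + Module.finrank ℝ (degreeLT (Fin 2) ℝ 2 ⊓ LinearMap.ker (vertexValues K) :
      Submodule ℝ Poly) = Module.finrank ℝ (degreeLT (Fin 2) ℝ 2) := by
    rw [← finrank_map_add_finrank_inf_ker (vertexValues K) (degreeLT (Fin 2) ℝ 2),
      map_vertexValues_degreeLT_two, finrank_top, Module.finrank_fin_fun]
  have hzero : Module.finrank ℝ (degreeLT (Fin 2) ℝ 2 ⊓ LinearMap.ker (vertexValues K) :
      Submodule ℝ Poly) = 0 := by omega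
  exact Submodule.finrank_eq_zero.1 hzero

/- The product of two barycentric coordinates vanishes at the vertices but has nonzero mean. -/
theorem map_vertexValues_prod_integralTri_degreeLT (m : ℕ) :
    (degreeLT (Fin 2) ℝ (m + 3)).map ((vertexValues K).prod (integralTri K)) = ⊤ := by
  refine eq_top_iff.2 fun ⟨v, c⟩ _ => ?_
  obtain ⟨u, hu, rfl⟩ : v ∈ (degreeLT (Fin 2) ℝ 2).map (vertexValues K) := by
    rw [map_vertexValues_degreeLT_two]
    trivial
  let w : Poly := bary K 0 * bary K 1
  have hw : w ∈ degreeLT (Fin 2) ℝ 3 :=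
    mem_degreeLT_succ.2 ((totalDegree_mul _ _).trans (by simp only [totalDegree_bary]; rfl))
  have hwv : vertexValues K w = 0 := funext fun i => by
    change evalAt (K.points i) (bary K 0 * bary K 1) = 0
    rw [evalAt_mul, evalAt_bary_points, evalAt_bary_points]
    fin_cases i <;> simp
  refine ⟨u + ((c - integralTri K u) / integralTri K w) • w,
    add_mem (degreeLT_mono (by omega) hu)
      (Submodule.smul_mem _ _ (degreeLT_mono (by omega) hw)), ?_⟩
  refine Prod.ext ?_ ?_
  · change vertexValues K (u + _ • w) = vertexValues K u
    rw [map_add, map_smul, hwv, smul_zero, add_zero]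
  · change integralTri K (u + _ • w) = c
    rw [map_add, map_smul, smul_eq_mul,
      div_mul_cancel₀ _ (integralTri_bary_mul_bary_pos K).ne', add_sub_cancel]

theorem map_polyDiv_prod_bubbleSpace (m : ℕ) :
    ((bubbleSpace K 1 (m + 4)).prod (bubbleSpace K 1 (m + 4))).map polyDiv =
      degreeLT (Fin 2) ℝ (m + 3) ⊓ LinearMap.ker ((vertexValues K).prod (integralTri K)) := by
  set B := (bubbleSpace K 1 (m + 4)).prod (bubbleSpace K 1 (m + 4)) with hB
  have : Module.Finite ℝ B := Module.Finite.iff_fg.2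
    ((Module.Finite.iff_fg.1 inferInstance).prod (Module.Finite.iff_fg.1 inferInstance))
  have hdimB : Module.finrank ℝ B = 2 * Module.finrank ℝ (degreeLT (Fin 2) ℝ (m + 1)) := by
    rw [hB, finrank_submodule_prod, finrank_bubbleSpace, two_mul,
      show m + 4 - 3 * 1 = m + 1 by omega]
  have hker : Module.finrank ℝ (B ⊓ LinearMap.ker polyDiv : Submodule ℝ (Poly × Poly)) ≤
      Module.finrank ℝ (degreeLT (Fin 2) ℝ (m - 1)) := by
    rw [show m - 1 = m + 5 - 3 * 2 by omega, ← finrank_bubbleSpace (K := K)]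
    exact (Submodule.finrank_mono (prod_bubbleSpace_inf_ker_polyDiv_le K _)).trans
      (Submodule.finrank_map_le _ _)
  have hmap := finrank_map_add_finrank_inf_ker polyDiv B
  have hrange : 4 + Module.finrank ℝ (degreeLT (Fin 2) ℝ (m + 3) ⊓
      LinearMap.ker ((vertexValues K).prod (integralTri K)) : Submodule ℝ Poly) =
        Module.finrank ℝ (degreeLT (Fin 2) ℝ (m + 3)) := by
    rw [← finrank_map_add_finrank_inf_ker ((vertexValues K).prod (integralTri K))
        (degreeLT (Fin 2) ℝ (m + 3)),
      map_vertexValues_prod_integralTri_degreeLT, finrank_top, Module.finrank_prod,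
      Module.finrank_fin_fun, Module.finrank_self]
  have hdim (n : ℕ) := two_mul_finrank_degreeLT_fin_two (R := ℝ) n
  have hcount : Module.finrank ℝ (degreeLT (Fin 2) ℝ (m + 3)) +
      Module.finrank ℝ (degreeLT (Fin 2) ℝ (m - 1)) ≤
        2 * Module.finrank ℝ (degreeLT (Fin 2) ℝ (m + 1)) + 4 := by
    rcases m with - | m
    · linarith [hdim 0, hdim 1, hdim 3]
    · rw [Nat.add_sub_cancel]
      linarith [hdim m, hdim (m + 2), hdim (m + 4)]
  refine Submodule.eq_of_le_of_finrank_le (map_polyDiv_prod_bubbleSpace_le K _) ?_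
  omega

theorem exists_div_eq_of_mem_degreeLT {k : ℕ} {q : Poly} (hq : q ∈ degreeLT (Fin 2) ℝ k)
    (hvert : ∀ i, evalAt (K.points i) q = 0) (hmean : integralTri K q = 0) :
    ∃ p ∈ (bubbleSpace K 1 (k + 1)).prod (bubbleSpace K 1 (k + 1)), polyDiv p = q := by
  rcases le_or_gt k 2 with hk | hk
  · have hq' : q ∈ degreeLT (Fin 2) ℝ 2 ⊓ LinearMap.ker (vertexValues K) :=
      ⟨degreeLT_mono hk hq, funext hvert⟩
    rw [degreeLT_two_inf_ker_vertexValues, Submodule.mem_bot] at hq'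
    exact ⟨0, zero_mem _, by rw [map_zero, hq']⟩
  · obtain ⟨m, rfl⟩ := Nat.exists_eq_add_of_le' hk
    have hq' : q ∈ degreeLT (Fin 2) ℝ (m + 3) ⊓
        LinearMap.ker ((vertexValues K).prod (integralTri K)) :=
      ⟨hq, Prod.ext (funext hvert) hmean⟩
    rwa [← map_polyDiv_prod_bubbleSpace] at hq'

end LocalDivergence

section Pieces

variable {Ω : Opens Pt} {K : Tri}

theorem ae_mem_interior_of_mem_closedInterior (Ω : Opens Pt) (K : Tri) :
    ∀ᵐ x ∂(volume.restrict (Ω : Set Pt)), x ∈ K.closedInterior → x ∈ K.interior :=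
  ae_restrict_of_ae <| (interior_ae_eq_closedInterior K).mem_iff.mono fun _ h => h.2

theorem HasPiece.unique (hK : K.interior ⊆ (Ω : Set Pt)) {v : L2 Ω} {p q : Poly}
    (hp : HasPiece Ω K v p) (hq : HasPiece Ω K v q) : p = q := by
  have hae : (fun x => evalAt x p) =ᵐ[volume.restrict K.interior] fun x => evalAt x q := by
    filter_upwards [ae_mono (Measure.restrict_mono_set volume hK) (hp.and hq),
      ae_restrict_mem (isOpen_interior K).measurableSet] with x hx hmem
    have hmem' := K.interior_subset_closedInterior hmem
    rw [← hx.1 hmem', ← hx.2 hmem']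
  have heq := Measure.eqOn_open_of_ae_eq hae (isOpen_interior K)
    (continuous_evalAt p).continuousOn (continuous_evalAt q).continuousOn
  refine sub_eq_zero.1 (eq_zero_of_evalAt_eq_zero_on_open (isOpen_interior K)
    (interior_nonempty K) fun x hx => ?_)
  rw [map_sub, sub_eq_zero]
  exact heq hx

theorem ae_eq_of_forall_integral_mul_eq {U : Opens Pt} (w : L2 Ω)
    {f : Pt → ℝ} (hf : Continuous f)
    (h : ∀ g, IsTest U g → ∫ x in (Ω : Set Pt), w x * g x = ∫ x in (Ω : Set Pt), f x * g x) :
    ∀ᵐ x ∂(volume.restrict (Ω : Set Pt)), x ∈ U → w x = f x := by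
  have hloc : LocallyIntegrableOn (fun x => w x - f x) U (volume.restrict (Ω : Set Pt)) :=
    (((Lp.memLp w).locallyIntegrable one_le_two).sub hf.locallyIntegrable).locallyIntegrableOn _
  have hae := U.isOpen.ae_eq_zero_of_integral_contDiff_smul_eq_zero hloc fun g hg hgc hgU => by
    have hw := integrable_mul Ω w hg.continuous hgc
    have hfg : Integrable (fun x => f x * g x) (volume.restrict (Ω : Set Pt)) :=
      ((hf.mul hg.continuous).integrable_of_hasCompactSupport hgc.mul_left).integrableOn
    simp only [smul_eq_mul, mul_comm (g _), sub_mul]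
    rw [integral_sub hw hfg, h g ⟨hg, hgc, hgU⟩, sub_self]
  filter_upwards [hae] with x hx hmem using sub_eq_zero.1 (hx hmem)

theorem HasPiece.wpartial (hK : K.interior ⊆ (Ω : Set Pt)) {v : L2 Ω} {p : Poly}
    (hp : HasPiece Ω K v p) (hv : v ∈ H1 Ω) (i : Fin 2) :
    HasPiece Ω K (wpartial i v) (pd i p) := by
  let U : Opens Pt := ⟨K.interior, isOpen_interior K⟩
  have hae := ae_eq_of_forall_integral_mul_eq (U := U) (StokesFE.wpartial i v)
    (continuous_evalAt (pd i p)) fun g hg => neg_injective ?_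
  · filter_upwards [hae, ae_mem_interior_of_mem_closedInterior Ω K] with x hx hint hmem
    exact hx (hint hmem)
  · have hgΩ : IsTest Ω g := ⟨hg.smooth, hg.compact, hg.support.trans hK⟩
    calc -∫ x in (Ω : Set Pt), StokesFE.wpartial i v x * g x
        = ∫ x in (Ω : Set Pt), v x * cpartial i g x := (hasWeakPartial_wpartial hv i g hgΩ).symm
      _ = ∫ x in (Ω : Set Pt), evalAt x p * cpartial i g x := by
        refine integral_congr_ae ?_
        filter_upwards [hp] with x hx
        by_cases hmem : x ∈ K.interior
        · rw [hx (K.interior_subset_closedInterior hmem)]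
        · rw [(hg.cpartial i).eq_zero_of_notMem hmem, mul_zero, mul_zero]
      _ = -∫ x in (Ω : Set Pt), evalAt x (pd i p) * g x := by
        rw [integral_mul_cpartial (contDiff_evalAt p) hgΩ i, cpartial_evalAt]

theorem HasPiece.div (hK : K.interior ⊆ (Ω : Set Pt)) {v : L2 Ω × L2 Ω} {p q : Poly}
    (hp : HasPiece Ω K v.1 p) (hq : HasPiece Ω K v.2 q) (hv : v ∈ (H1 Ω).prod (H1 Ω)) :
    HasPiece Ω K (div v) (polyDiv (p, q)) :=
  (hp.wpartial hK hv.1 0).add (hq.wpartial hK hv.2 1)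

theorem HasPiece.setIntegral_eq (hK : K.interior ⊆ (Ω : Set Pt)) {v : L2 Ω} {p : Poly}
    (hp : HasPiece Ω K v p) :
    ∫ x in K.closedInterior, v x ∂(volume.restrict (Ω : Set Pt)) = integralTri K p := by
  have hint : (K.closedInterior : Set Pt) =ᵐ[volume.restrict (Ω : Set Pt)] K.interior :=
    ae_restrict_of_ae (interior_ae_eq_closedInterior K).symm
  rw [setIntegral_congr_ae K.isClosed_closedInterior.measurableSet hp, setIntegral_congr_set hint,
    Measure.restrict_restrict (isOpen_interior K).measurableSet, Set.inter_eq_left.2 hK,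
    integralTri_eq_setIntegral_interior]

theorem HasPiece.neg {v : L2 Ω} {p : Poly} (hp : HasPiece Ω K v p) : HasPiece Ω K (-v) (-p) := by
  simpa only [neg_one_smul] using hp.smul (-1)

theorem hasPiece_pieceL2 (Ω : Opens Pt) (K : Tri) (p : Poly) :
    HasPiece Ω K (pieceL2 Ω K p) p := by
  filter_upwards [coeFn_pieceL2 Ω K p, ae_mem_interior_of_mem_closedInterior Ω K]
    with x hx hint hmem
  rw [hx, zeroExtend_of_mem K (hint hmem)]

theorem hasPiece_sum {ι : Type*} (s : Finset ι) {v : ι → L2 Ω} {p : ι → Poly}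
    (h : ∀ i ∈ s, HasPiece Ω K (v i) (p i)) : HasPiece Ω K (∑ i ∈ s, v i) (∑ i ∈ s, p i) := by
  classical
  induction s using Finset.induction_on with
  | empty => exact hasPiece_zero Ω K
  | insert i s hi ih =>
    rw [Finset.sum_insert hi, Finset.sum_insert hi]
    exact (h i (Finset.mem_insert_self i s)).add
      (ih fun j hj => h j (Finset.mem_insert_of_mem hj))

theorem SameJet.pd {m : ℕ} {x : Pt} {p q : Poly} (h : SameJet (m + 1) x p q) (l : Fin 2) :
    SameJet m x (pd l p) (pd l q) := by
  have hcomm : Commute (StokesFE.pd 1) (StokesFE.pd 0) := LinearMap.ext (pderiv_comm 1 0)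
  intro i j hij
  fin_cases l
  · have hpow (p : Poly) : (StokesFE.pd 0 ^ i) ((StokesFE.pd 1 ^ j) (StokesFE.pd 0 p)) =
        (StokesFE.pd 0 ^ (i + 1)) ((StokesFE.pd 1 ^ j) p) := by
      rw [pow_succ, Module.End.mul_apply]
      exact congrArg _ (LinearMap.congr_fun (hcomm.pow_left j) p)
    exact (congrArg _ (hpow p)).trans
      ((h (i + 1) j (by omega)).trans (congrArg _ (hpow q)).symm)
  · exact h i (j + 1) (by omega)

theorem evalAt_pd_eq_zero_of_normal {p : Poly} {A B x : Pt}
    (h : ∀ y ∈ segment ℝ A B, evalAt y p = 0) (hx : x ∈ segment ℝ A B)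
    (hnormal : ∀ ν : Pt, inner ℝ ν (B - A) = 0 → ∑ l, ν l * evalAt x (pd l p) = 0)
    (l : Fin 2) : evalAt x (pd l p) = 0 := by
  have htangent : ∑ l, (B - A) l * evalAt x (pd l p) = 0 := by
    rw [segment_eq_image_lineMap] at hx h
    obtain ⟨t, -, rfl⟩ := hx
    have hline := evalAt_eq_zero_on_line fun s hs => h _ ⟨s, Set.Ioo_subset_Icc_self hs, rfl⟩
    have hderiv := hasDerivAt_evalAt_lineMap p A B t
    simp only [hline] at hderiv
    exact hderiv.unique (hasDerivAt_const t 0)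
  -- The gradient has no tangential part, so it is itself a normal vector.
  have hself := hnormal (WithLp.toLp 2 fun l => evalAt x (pd l p)) (by
    rwa [PiLp.inner_apply])
  exact mul_self_eq_zero.1
    ((Finset.sum_eq_zero_iff_of_nonneg fun l _ => mul_self_nonneg _).1 hself l (Finset.mem_univ l))

theorem mem_bubbleSpace_one_of_zeroOnBoundary (hK : K.interior ⊆ (Ω : Set Pt)) {v : L2 Ω}
    {p : Poly} {m : ℕ} (hp : HasPiece Ω K v p) (hdeg : p ∈ degreeLT (Fin 2) ℝ m)
    (h : ZeroOnBoundary K v) : p ∈ bubbleSpace K 1 m := by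
  obtain ⟨q, hq, hzero⟩ := h
  obtain rfl := hp.unique hK hq
  rw [mem_bubbleSpace, pow_one]
  exact ⟨hdeg, bubble_dvd K fun i t ht => hzero _ _ (by simp) _ (edge_mem_segment K i ht)⟩

theorem mem_bubbleSpace_two_of_zeroNormalDerivOnBoundary (hK : K.interior ⊆ (Ω : Set Pt))
    {v : L2 Ω} {p : Poly} {m : ℕ} (hp : HasPiece Ω K v p) (hdeg : p ∈ degreeLT (Fin 2) ℝ m)
    (h : ZeroOnBoundary K v) (hnormal : ZeroNormalDerivOnBoundary K v) :
    p ∈ bubbleSpace K 2 m := by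
  obtain ⟨q, hq, hzero⟩ := h
  obtain rfl := hp.unique hK hq
  obtain ⟨q, hq, hν⟩ := hnormal
  obtain rfl := hp.unique hK hq
  have hne : ∀ i : Fin 3, i + 1 ≠ i + 2 := by decide
  exact mem_bubbleSpace.2 ⟨hdeg, bubble_sq_dvd K
    (fun i t ht => hzero _ _ (hne i) _ (edge_mem_segment K i ht))
    fun l i t ht => evalAt_pd_eq_zero_of_normal (hzero _ _ (hne i)) (edge_mem_segment K i ht)
      (hν _ _ (hne i) _ (edge_mem_segment K i ht)) l⟩

theorem zeroOnBoundary_of_mem_bubbleSpace {v : L2 Ω} {p : Poly} {m : ℕ} (h : HasPiece Ω K v p)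
    (hp : p ∈ bubbleSpace K 1 m) : ZeroOnBoundary K v :=
  ⟨p, h, fun _ _ hij _ hx => evalAt_eq_zero_of_mem_segment hp hij hx⟩

theorem zeroNormalDerivOnBoundary_of_mem_bubbleSpace {v : L2 Ω} {p : Poly} {m : ℕ}
    (h : HasPiece Ω K v p) (hp : p ∈ bubbleSpace K 2 (m + 1)) : ZeroNormalDerivOnBoundary K v :=
  ⟨p, h, fun _ _ hij _ hx _ _ => Finset.sum_eq_zero fun l _ => by
    rw [evalAt_eq_zero_of_mem_segment (pd_mem_bubbleSpace hp l) hij hx, mul_zero]⟩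

theorem eq_zero_of_mem_bubbleSpace_of_pd_eq_zero {p : Poly} {m : ℕ} (hp : p ∈ bubbleSpace K 1 m)
    (h : ∀ l, pd l p = 0) : p = 0 := by
  have hC := eq_C_of_pderiv_eq_zero h
  have hzero := evalAt_edge_eq_zero hp 0 0
  rw [hC, evalAt_C] at hzero
  rw [hC, hzero, C_0]

end Pieces

section Mesh

variable {n : ℕ} {Ω : Opens Pt} {P : Polygon Pt n} {T : Finset Tri}

theorem IsMesh.isFiniteMeasure (hT : IsMesh Ω T) (μ : Measure Pt) [IsFiniteMeasureOnCompacts μ] :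
    IsFiniteMeasure (μ.restrict (Ω : Set Pt)) := by
  have hcompact : IsCompact (closure (Ω : Set Pt)) := by
    rw [← hT.cover]
    exact T.isCompact_biUnion fun K _ => K.isCompact_closedInterior
  exact isFiniteMeasure_restrict.2
    ((measure_mono subset_closure).trans_lt hcompact.measure_lt_top).ne

theorem IsMesh.volume_inter (hT : IsMesh Ω T) {K K' : Tri} (hK : K ∈ T) (hK' : K' ∈ T)
    (h : K ≠ K') : volume (K.closedInterior ∩ K'.closedInterior) = 0 := by
  rcases hT.conforming K hK K' hK' h with h | ⟨x, -, h⟩ | ⟨x, -, y, -, -, h⟩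
  · rw [h, measure_empty]
  · rw [h, measure_singleton]
  · rw [h, volume_segment]

theorem IsMesh.ext (hT : IsMesh Ω T) {v w : L2 Ω}
    (h : ∀ K ∈ T, ∃ p, HasPiece Ω K v p ∧ HasPiece Ω K w p) : v = w := by
  have hae : ∀ᵐ x ∂(volume.restrict (Ω : Set Pt)), ∀ K ∈ T, x ∈ K.closedInterior → v x = w x := by
    refine (ae_ball_iff (S := (T : Set Tri)) T.countable_toSet).2 fun K hK => ?_
    obtain ⟨p, hv, hw⟩ := h K hK
    filter_upwards [hv, hw] with x hx hx' hmem
    rw [hx hmem, hx' hmem]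
  refine Lp.ext ?_
  filter_upwards [hae, ae_restrict_mem Ω.isOpen.measurableSet] with x hx hmem
  obtain ⟨K, hK, hxK⟩ := Set.mem_iUnion₂.1 (hT.cover.ge (subset_closure hmem))
  exact hx K hK hxK

theorem IsMesh.hasPiece_pieceL2_of_ne (hT : IsMesh Ω T) {K K' : Tri} (hK : K ∈ T) (hK' : K' ∈ T)
    (h : K ≠ K') (p : Poly) : HasPiece Ω K' (pieceL2 Ω K p) 0 := by
  have hnull : ∀ᵐ x ∂(volume.restrict (Ω : Set Pt)), x ∉ K.closedInterior ∩ K'.closedInterior :=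
    ae_restrict_of_ae (measure_eq_zero_iff_ae_notMem.1 (hT.volume_inter hK hK' h))
  filter_upwards [coeFn_pieceL2 Ω K p, hnull] with x hx hdisj hmem
  rw [hx, zeroExtend_of_notMem K (fun hxK => hdisj ⟨K.interior_subset_closedInterior hxK, hmem⟩),
    map_zero]

/-- The function on the mesh `T` that is `p K` on each element `K`, as an element of `L²(Ω)`. -/
def glue (Ω : Opens Pt) (T : Finset Tri) (p : Tri → Poly) : L2 Ω := ∑ K ∈ T, pieceL2 Ω K (p K)

theorem IsMesh.hasPiece_glue (hT : IsMesh Ω T) (p : Tri → Poly) {K : Tri} (hK : K ∈ T) :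
    HasPiece Ω K (glue Ω T p) (p K) := by
  classical
  have h : HasPiece Ω K (glue Ω T p) (∑ K' ∈ T, if K' = K then p K' else 0) := by
    refine hasPiece_sum T fun K' hK' => ?_
    split_ifs with h
    · subst h
      exact hasPiece_pieceL2 Ω K' _
    · exact hT.hasPiece_pieceL2_of_ne hK' hK h _
  rwa [Finset.sum_ite_eq' T K p, if_pos hK] at h

theorem IsMesh.eq_glue (hT : IsMesh Ω T) {v : L2 Ω} {p : Tri → Poly}
    (h : ∀ K ∈ T, HasPiece Ω K v (p K)) : v = glue Ω T p :=
  hT.ext fun K hK => ⟨p K, h K hK, hT.hasPiece_glue p hK⟩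

theorem IsMesh.finiteDimensional_piecewisePoly (hT : IsMesh Ω T) (d m : ℕ) :
    FiniteDimensional ℝ (piecewisePoly Ω P T d m) := by
  let f : (T → degreeLT (Fin 2) ℝ (d + 1)) →ₗ[ℝ] L2 Ω :=
    ∑ K : T, pieceL2 Ω K.1 ∘ₗ (degreeLT (Fin 2) ℝ (d + 1)).subtype ∘ₗ LinearMap.proj K
  have hle : piecewisePoly Ω P T d m ≤ LinearMap.range f := by
    rintro v ⟨p, hp, -⟩
    refine ⟨fun K => ⟨p K, mem_degreeLT_succ.2 (hp K K.2).1⟩,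
      Eq.trans ?_ (hT.eq_glue fun K hK => (hp K hK).2).symm⟩
    rw [glue, ← Finset.sum_coe_sort]
    simp [f]
  exact Submodule.finiteDimensional_of_le hle

theorem IsMesh.wpartial_mem_piecewisePoly (hT : IsMesh Ω T) {d m : ℕ} {v : L2 Ω} (hv : v ∈ H1 Ω)
    (h : v ∈ piecewisePoly Ω P T d (m + 1)) (l : Fin 2) :
    wpartial l v ∈ piecewisePoly Ω P T (d - 1) m := by
  obtain ⟨p, hp, hjet⟩ := h
  refine ⟨fun K => pd l (p K), fun K hK => ⟨?_, ?_⟩, fun x hx K hK K' hK' hxK hxK' =>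
    (hjet x hx K hK K' hK' hxK hxK').pd l⟩
  · exact mem_degreeLT_succ.1 (pderiv_mem_degreeLT l
      (degreeLT_mono (by omega) (mem_degreeLT_succ.2 (hp K hK).1)))
  · exact (hp K hK).2.wpartial (hT.interior_subset K hK) hv l

theorem IsMesh.div_mem_Q0 {k : ℕ} (hT : IsMesh Ω T) {v : L2 Ω × L2 Ω} (hv : v ∈ V0 Ω P T k) :
    div v ∈ Q0 Ω P T k := by
  have := hT.isFiniteMeasure volume
  have hL20 {u : L2 Ω} (hu : u ∈ H10 Ω) (i : Fin 2) : wpartial i u ∈ L20 Ω :=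
    ⟨(Lp.memLp _).integrable one_le_two, integral_wpartial_eq_zero hu i⟩
  exact ⟨add_mem (hT.wpartial_mem_piecewisePoly hv.1.1.1 hv.1.1.2 0)
      (hT.wpartial_mem_piecewisePoly hv.2.1.1 hv.2.1.2 1),
    add_mem (hL20 hv.1.2 0) (hL20 hv.2.2 1)⟩

end Mesh

section BubbleFunctions

/-- The functions whose restriction to each element `K` of the mesh is a polynomial of total degree
less than `m` divisible by `bubble K ^ j`. -/
def bubbleFunctions (Ω : Opens Pt) (T : Finset Tri) (j m : ℕ) : Submodule ℝ (L2 Ω) where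
  carrier := {v | ∀ K ∈ T, ∃ p ∈ bubbleSpace K j m, HasPiece Ω K v p}
  add_mem' hu hv K hK :=
    have ⟨p, hp, hup⟩ := hu K hK
    have ⟨q, hq, hvq⟩ := hv K hK
    ⟨p + q, add_mem hp hq, hup.add hvq⟩
  zero_mem' K _ := ⟨0, zero_mem _, hasPiece_zero Ω K⟩
  smul_mem' c _ hv K hK :=
    have ⟨p, hp, hvp⟩ := hv K hK
    ⟨c • p, Submodule.smul_mem _ c hp, hvp.smul c⟩

variable {n : ℕ} {Ω : Opens Pt} {P : Polygon Pt n} {T : Finset Tri} {j k m : ℕ}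

theorem bubbleFunctions_anti {j' : ℕ} (h : j ≤ j') :
    bubbleFunctions Ω T j' m ≤ bubbleFunctions Ω T j m := fun v hv K hK => by
  obtain ⟨p, hp, hvp⟩ := hv K hK
  obtain ⟨hdeg, hdvd⟩ := mem_bubbleSpace.1 hp
  exact ⟨p, mem_bubbleSpace.2 ⟨hdeg, (pow_dvd_pow _ h).trans hdvd⟩, hvp⟩

theorem IsMesh.exists_eq_glue_of_mem_bubbleFunctions (hT : IsMesh Ω T) {v : L2 Ω}
    (hv : v ∈ bubbleFunctions Ω T j m) :
    ∃ p : Tri → Poly, (∀ K ∈ T, p K ∈ bubbleSpace K j m) ∧ v = glue Ω T p := by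
  have hv' : ∀ K ∈ T, ∃ p ∈ bubbleSpace K j m, HasPiece Ω K v p := hv
  choose! p hp hvp using hv'
  exact ⟨p, hp, hT.eq_glue hvp⟩

theorem IsMesh.glue_mem_bubbleFunctions (hT : IsMesh Ω T) {p : Tri → Poly}
    (hp : ∀ K ∈ T, p K ∈ bubbleSpace K j m) : glue Ω T p ∈ bubbleFunctions Ω T j m :=
  fun K hK => ⟨p K, hp K hK, hT.hasPiece_glue p hK⟩

theorem IsMesh.bubbleFunctions_one_le_H10 (hT : IsMesh Ω T) : bubbleFunctions Ω T 1 m ≤ H10 Ω := by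
  have := hT.isFiniteMeasure volume
  intro v hv
  obtain ⟨p, hp, rfl⟩ := hT.exists_eq_glue_of_mem_bubbleFunctions hv
  exact sum_mem fun K hK => pieceL2_mem_H10 (hT.interior_subset K hK)
    (by simpa only [pow_one] using (mem_bubbleSpace.1 (hp K hK)).2)

theorem IsMesh.bubbleFunctions_two_le_H20 (hT : IsMesh Ω T) : bubbleFunctions Ω T 2 m ≤ H20 Ω := by
  have := hT.isFiniteMeasure volume
  intro v hv
  obtain ⟨p, hp, rfl⟩ := hT.exists_eq_glue_of_mem_bubbleFunctions hv
  exact sum_mem fun K hK => pieceL2_mem_H20 (hT.interior_subset K hK)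
    (mem_bubbleSpace.1 (hp K hK)).2

theorem IsMesh.bubbleFunctions_le_piecewisePoly (hT : IsMesh Ω T) {d : ℕ} (hm : m < 2 * j) :
    bubbleFunctions Ω T j (d + 1) ≤ piecewisePoly Ω P T d m := by
  intro v hv
  obtain ⟨p, hp, rfl⟩ := hT.exists_eq_glue_of_mem_bubbleFunctions hv
  refine ⟨p, fun K hK => ⟨mem_degreeLT_succ.1 (mem_bubbleSpace.1 (hp K hK)).1,
    hT.hasPiece_glue p hK⟩, ?_⟩
  have hjet : ∀ K ∈ T, ∀ x ∈ Set.range K.points, ∀ i l, i + l ≤ m →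
      evalAt x ((pd 0 ^ i) ((pd 1 ^ l) (p K))) = 0 := by
    rintro K hK _ ⟨s, rfl⟩ i l hil
    exact evalAt_pd_pow_eq_zero
      (Ideal.pow_le_pow_right hm (mem_pointIdeal_of_mem_bubbleSpace (hp K hK) s)) hil
  rintro x - K hK K' hK' hxK hxK' i l hil
  rw [hjet K hK x hxK i l hil, hjet K' hK' x hxK' i l hil]

theorem IsMesh.mem_bubbleFunctions_one (hT : IsMesh Ω T) {d : ℕ} {v : L2 Ω}
    (hv : v ∈ piecewisePoly Ω P T d m) (h : ∀ K ∈ T, ZeroOnBoundary K v) :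
    v ∈ bubbleFunctions Ω T 1 (d + 1) := fun K hK => by
  obtain ⟨p, hp, -⟩ := hv
  exact ⟨p K, mem_bubbleSpace_one_of_zeroOnBoundary (hT.interior_subset K hK) (hp K hK).2
    (mem_degreeLT_succ.2 (hp K hK).1) (h K hK), (hp K hK).2⟩

theorem IsMesh.mem_bubbleFunctions_two (hT : IsMesh Ω T) {d : ℕ} {v : L2 Ω}
    (hv : v ∈ piecewisePoly Ω P T d m)
    (h : ∀ K ∈ T, ZeroOnBoundary K v ∧ ZeroNormalDerivOnBoundary K v) :
    v ∈ bubbleFunctions Ω T 2 (d + 1) := fun K hK => by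
  obtain ⟨p, hp, -⟩ := hv
  exact ⟨p K, mem_bubbleSpace_two_of_zeroNormalDerivOnBoundary (hT.interior_subset K hK)
    (hp K hK).2 (mem_degreeLT_succ.2 (hp K hK).1) (h K hK).1 (h K hK).2, (hp K hK).2⟩

theorem zeroOnBoundary_of_mem_bubbleFunctions {v : L2 Ω} (hv : v ∈ bubbleFunctions Ω T 1 m)
    {K : Tri} (hK : K ∈ T) : ZeroOnBoundary K v := by
  obtain ⟨p, hp, hvp⟩ := hv K hK
  exact zeroOnBoundary_of_mem_bubbleSpace hvp hp

theorem zeroNormalDerivOnBoundary_of_mem_bubbleFunctions {v : L2 Ω}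
    (hv : v ∈ bubbleFunctions Ω T 2 (m + 1)) {K : Tri} (hK : K ∈ T) :
    ZeroNormalDerivOnBoundary K v := by
  obtain ⟨p, hp, hvp⟩ := hv K hK
  exact zeroNormalDerivOnBoundary_of_mem_bubbleSpace hvp hp

theorem IsMesh.VI_eq (hT : IsMesh Ω T) :
    VI Ω P T k = (bubbleFunctions Ω T 1 (k + 1)).prod (bubbleFunctions Ω T 1 (k + 1)) := by
  have hV {v : L2 Ω} (hv : v ∈ bubbleFunctions Ω T 1 (k + 1)) : v ∈ V Ω P T k ⊓ H10 Ω :=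
    have hv10 := hT.bubbleFunctions_one_le_H10 hv
    ⟨⟨hv10.1, hT.bubbleFunctions_le_piecewisePoly (by omega) hv⟩, hv10⟩
  refine le_antisymm (fun v hv => ?_) fun v hv => ?_
  · exact ⟨hT.mem_bubbleFunctions_one hv.1.1.1.2 fun K hK => (hv.2 K hK).1,
      hT.mem_bubbleFunctions_one hv.1.2.1.2 fun K hK => (hv.2 K hK).2⟩
  · exact ⟨⟨hV hv.1, hV hv.2⟩, fun K hK =>
      ⟨zeroOnBoundary_of_mem_bubbleFunctions hv.1 hK,
        zeroOnBoundary_of_mem_bubbleFunctions hv.2 hK⟩⟩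

theorem IsMesh.SigmaI_eq (hT : IsMesh Ω T) : SigmaI Ω P T k = bubbleFunctions Ω T 2 (k + 2) := by
  refine le_antisymm (fun ψ hψ => hT.mem_bubbleFunctions_two hψ.1.2 hψ.2) fun ψ hψ => ?_
  exact ⟨⟨hT.bubbleFunctions_two_le_H20 hψ, hT.bubbleFunctions_le_piecewisePoly (by omega) hψ⟩,
    fun K hK => ⟨zeroOnBoundary_of_mem_bubbleFunctions (bubbleFunctions_anti one_le_two hψ) hK,
      zeroNormalDerivOnBoundary_of_mem_bubbleFunctions hψ hK⟩⟩

theorem IsMesh.eq_zero_of_wpartial_eq_zero (hT : IsMesh Ω T) {v : L2 Ω}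
    (hv : v ∈ bubbleFunctions Ω T 1 m) (h : ∀ l, wpartial l v = 0) : v = 0 := by
  refine hT.ext fun K hK => ⟨0, ?_, hasPiece_zero Ω K⟩
  obtain ⟨p, hp, hvp⟩ := hv K hK
  have hKΩ := hT.interior_subset K hK
  have hpd (l : Fin 2) : pd l p = 0 := by
    have hl := hvp.wpartial hKΩ (hT.bubbleFunctions_one_le_H10 hv).1 l
    rw [h l] at hl
    exact hl.unique hKΩ (hasPiece_zero Ω K)
  rwa [eq_zero_of_mem_bubbleSpace_of_pd_eq_zero hp hpd] at hvp

end BubbleFunctions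

section InteriorComplex

variable {n : ℕ} {Ω : Opens Pt} {P : Polygon Pt n} {T : Finset Tri} {k m : ℕ}

theorem IsMesh.wpartial_mem_bubbleFunctions (hT : IsMesh Ω T) {v : L2 Ω}
    (hv : v ∈ bubbleFunctions Ω T 2 (m + 1)) (l : Fin 2) :
    wpartial l v ∈ bubbleFunctions Ω T 1 m := fun K hK => by
  obtain ⟨p, hp, hvp⟩ := hv K hK
  exact ⟨pd l p, pd_mem_bubbleSpace hp l,
    hvp.wpartial (hT.interior_subset K hK) (hT.bubbleFunctions_two_le_H20 hv).1.1 l⟩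

theorem IsMesh.curl_mem_VI (hT : IsMesh Ω T) {ψ : L2 Ω} (hψ : ψ ∈ SigmaI Ω P T k) :
    curl ψ ∈ VI Ω P T k := by
  rw [hT.SigmaI_eq] at hψ
  rw [hT.VI_eq]
  exact ⟨hT.wpartial_mem_bubbleFunctions hψ 1, neg_mem (hT.wpartial_mem_bubbleFunctions hψ 0)⟩

theorem IsMesh.div_curl (hT : IsMesh Ω T) {ψ : L2 Ω} (hψ : ψ ∈ SigmaI Ω P T k) :
    div (curl ψ) = 0 := by
  refine hT.ext fun K hK => ⟨0, ?_, hasPiece_zero Ω K⟩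
  obtain ⟨p, hp, -⟩ := hψ.1.2
  have hKΩ := hT.interior_subset K hK
  have hpd := (hp K hK).2.wpartial hKΩ hψ.1.1.1.1
  have hdiv := HasPiece.div hKΩ (v := curl ψ) (hpd 1) (HasPiece.neg (hpd 0)) (curl_mem hψ.1.1.1)
  have hzero : polyDiv (pd 1 (p K), -pd 0 (p K)) = 0 := by
    change pd 0 (pd 1 (p K)) + pd 1 (-pd 0 (p K)) = 0
    rw [map_neg, ← sub_eq_add_neg, sub_eq_zero]
    exact pderiv_comm 0 1 (p K)
  rwa [hzero] at hdiv

theorem IsMesh.div_mem_QI (hT : IsMesh Ω T) {v : L2 Ω × L2 Ω} (hv : v ∈ VI Ω P T k) :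
    div v ∈ QI Ω P T k := by
  refine ⟨hT.div_mem_Q0 hv.1, fun K hK => ?_⟩
  have hKΩ := hT.interior_subset K hK
  have hv1 := V0_le Ω P T k hv.1
  rw [hT.VI_eq] at hv
  obtain ⟨p, hp, hvp⟩ := hv.1 K hK
  obtain ⟨q, hq, hvq⟩ := hv.2 K hK
  have hdiv := hvp.div hKΩ hvq hv1
  have hker := (map_polyDiv_prod_bubbleSpace_le K k ⟨(p, q), ⟨hp, hq⟩, rfl⟩).2
  exact ⟨(hdiv.setIntegral_eq hKΩ).trans (congrArg Prod.snd hker),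
    _, hdiv, congrFun (congrArg Prod.fst hker)⟩

theorem IsMesh.exists_div_eq (hT : IsMesh Ω T) (hk : 1 ≤ k) {q : L2 Ω} (hq : q ∈ QI Ω P T k) :
    ∃ v ∈ VI Ω P T k, div v = q := by
  have hlocal : ∀ K ∈ T, ∃ p : Poly × Poly,
      p ∈ (bubbleSpace K 1 (k + 1)).prod (bubbleSpace K 1 (k + 1)) ∧
        HasPiece Ω K q (polyDiv p) := fun K hK => by
    have hKΩ := hT.interior_subset K hK
    obtain ⟨⟨⟨r, hr, -⟩, -⟩, hI⟩ := hq
    obtain ⟨hmean, r', hqr', hvert⟩ := hI K hK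
    obtain rfl := hqr'.unique hKΩ (hr K hK).2
    rw [hqr'.setIntegral_eq hKΩ] at hmean
    have hdeg : r K ∈ degreeLT (Fin 2) ℝ k :=
      degreeLT_mono (by omega) (mem_degreeLT_succ.2 (hr K hK).1)
    obtain ⟨p, hp, hpr⟩ := exists_div_eq_of_mem_degreeLT K hdeg hvert hmean
    exact ⟨p, hp, hpr ▸ hqr'⟩
  choose! p hp hqp using hlocal
  have hmem : (glue Ω T fun K => (p K).1, glue Ω T fun K => (p K).2) ∈ VI Ω P T k := by
    rw [hT.VI_eq]
    exact ⟨hT.glue_mem_bubbleFunctions fun K hK => (hp K hK).1,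
      hT.glue_mem_bubbleFunctions fun K hK => (hp K hK).2⟩
  refine ⟨_, hmem, hT.ext fun K hK => ⟨_, ?_, hqp K hK⟩⟩
  exact HasPiece.div (hT.interior_subset K hK) (hT.hasPiece_glue (fun K => (p K).1) hK)
    (hT.hasPiece_glue (fun K => (p K).2) hK) (V0_le Ω P T k hmem.1)

theorem IsMesh.exists_curl_eq (hT : IsMesh Ω T) {v : L2 Ω × L2 Ω} (hv : v ∈ VI Ω P T k)
    (h : div v = 0) : ∃ ψ ∈ SigmaI Ω P T k, curl ψ = v := by
  have hv1 := V0_le Ω P T k hv.1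
  rw [hT.VI_eq] at hv
  have hlocal : ∀ K ∈ T, ∃ φ ∈ bubbleSpace K 2 (k + 2),
      HasPiece Ω K v.1 (pd 1 φ) ∧ HasPiece Ω K v.2 (-pd 0 φ) := fun K hK => by
    have hKΩ := hT.interior_subset K hK
    obtain ⟨p, hp, hvp⟩ := hv.1 K hK
    obtain ⟨q, hq, hvq⟩ := hv.2 K hK
    have hdiv := hvp.div hKΩ hvq hv1
    rw [h] at hdiv
    obtain ⟨φ, hφ, rfl, hφq⟩ :=
      exists_curl_eq_of_mem_bubbleSpace hp hq (hdiv.unique hKΩ (hasPiece_zero Ω K))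
    exact ⟨φ, hφ, hvp, by rwa [hφq, neg_neg]⟩
  choose! φ hφ hφ1 hφ2 using hlocal
  have hmem : glue Ω T φ ∈ SigmaI Ω P T k := by
    rw [hT.SigmaI_eq]
    exact hT.glue_mem_bubbleFunctions hφ
  have hpd (l : Fin 2) {K : Tri} (hK : K ∈ T) :
      HasPiece Ω K (wpartial l (glue Ω T φ)) (pd l (φ K)) :=
    (hT.hasPiece_glue φ hK).wpartial (hT.interior_subset K hK) hmem.1.1.1.1 l
  refine ⟨_, hmem, Prod.ext (hT.ext fun K hK => ⟨_, hpd 1 hK, hφ1 K hK⟩)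
    (hT.ext fun K hK => ⟨_, ?_, hφ2 K hK⟩)⟩
  exact HasPiece.neg (hpd 0 hK)

end InteriorComplex

section Energy

variable {n : ℕ} {Ω : Opens Pt} {P : Polygon Pt n} {T : Finset Tri} {k : ℕ}

/-- The gradient of a vector field, in the Hilbert space whose inner product is the
integral of `∇u : ∇v`. -/
def grad : (H1 Ω).prod (H1 Ω) →ₗ[ℝ] PiLp 2 fun _ : Fin 2 => WithLp 2 (L2 Ω × L2 Ω) where
  toFun v := WithLp.toLp 2 fun j => WithLp.toLp 2 (wpartial j v.1.1, wpartial j v.1.2)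
  map_add' u v := by
    ext1 j
    exact congrArg (WithLp.toLp 2)
      (Prod.ext (wpartial_add j u.2.1 v.2.1) (wpartial_add j u.2.2 v.2.2))
  map_smul' c v := by
    ext1 j
    exact congrArg (WithLp.toLp 2)
      (Prod.ext (wpartial_smul j c v.2.1) (wpartial_smul j c v.2.2))

theorem inner_grad (u v : (H1 Ω).prod (H1 Ω)) : inner ℝ (grad u) (grad v) = a u.1 v.1 := by
  simp only [PiLp.inner_apply, WithLp.prod_inner_apply]
  rfl

theorem a_sub_left {u v w : L2 Ω × L2 Ω} (hu : u ∈ (H1 Ω).prod (H1 Ω))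
    (hv : v ∈ (H1 Ω).prod (H1 Ω)) : a (u - v) w = a u w - a v w :=
  eq_sub_of_add_eq (by rw [← a_add_left (sub_mem hu hv) hv, sub_add_cancel])

theorem div_sub {u v : L2 Ω × L2 Ω} (hu : u ∈ (H1 Ω).prod (H1 Ω))
    (hv : v ∈ (H1 Ω).prod (H1 Ω)) : div (u - v) = div u - div v :=
  eq_sub_of_add_eq (by rw [← div_add (sub_mem hu hv) hv, sub_add_cancel])

theorem curl_sub {φ ψ : L2 Ω} (hφ : φ ∈ H1 Ω) (hψ : ψ ∈ H1 Ω) : curl (φ - ψ) = curl φ - curl ψ :=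
  eq_sub_of_add_eq (by rw [← curl_add (sub_mem hφ hψ) hψ, sub_add_cancel])

theorem IsMesh.eq_zero_of_a_self (hT : IsMesh Ω T) {v : L2 Ω × L2 Ω} (hv : v ∈ VI Ω P T k)
    (h : a v v = 0) : v = 0 := by
  have hgrad : grad ⟨v, V0_le Ω P T k hv.1⟩ = 0 := by
    rwa [← inner_self_eq_zero (𝕜 := ℝ), inner_grad]
  have hj (j : Fin 2) : (wpartial j v.1, wpartial j v.2) = 0 :=
    congrArg WithLp.ofLp (congrArg (fun z => z j) hgrad)
  rw [hT.VI_eq] at hv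
  exact Prod.ext (hT.eq_zero_of_wpartial_eq_zero hv.1 fun j => congrArg Prod.fst (hj j))
    (hT.eq_zero_of_wpartial_eq_zero hv.2 fun j => congrArg Prod.snd (hj j))

theorem IsMesh.eq_zero_of_a_curl_self (hT : IsMesh Ω T) {ψ : L2 Ω} (hψ : ψ ∈ SigmaI Ω P T k)
    (h : a (curl ψ) (curl ψ) = 0) : ψ = 0 := by
  have hcurl := hT.eq_zero_of_a_self (hT.curl_mem_VI hψ) h
  rw [hT.SigmaI_eq] at hψ
  exact hT.eq_zero_of_wpartial_eq_zero (bubbleFunctions_anti one_le_two hψ)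
    (Fin.forall_fin_two.2 ⟨neg_eq_zero.1 (congrArg Prod.snd hcurl), congrArg Prod.fst hcurl⟩)

theorem exists_forall_inner_map_eq {𝕜 S E : Type*} [RCLike 𝕜] [AddCommGroup S] [Module 𝕜 S]
    [FiniteDimensional 𝕜 S] [NormedAddCommGroup E] [InnerProductSpace 𝕜 E] (f : S →ₗ[𝕜] E)
    (x : E) : ∃ s, ∀ t, inner 𝕜 (f s) (f t) = inner 𝕜 x (f t) := by
  obtain ⟨_, ⟨s, rfl⟩, z, hz, rfl⟩ := (LinearMap.range f).exists_add_mem_mem_orthogonal x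
  refine ⟨s, fun t => ?_⟩
  rw [inner_add_left, Submodule.inner_left_of_mem_orthogonal (LinearMap.mem_range_self f t) hz,
    add_zero]

theorem IsMesh.exists_curl_projection (hT : IsMesh Ω T) {v : L2 Ω × L2 Ω}
    (hv : v ∈ (H1 Ω).prod (H1 Ω)) :
    ∃ ψ ∈ SigmaI Ω P T k, ∀ χ ∈ SigmaI Ω P T k, a (v - curl ψ) (curl χ) = 0 := by
  have : FiniteDimensional ℝ (piecewisePoly Ω P T (k + 1) 2) :=
    hT.finiteDimensional_piecewisePoly _ _
  have : FiniteDimensional ℝ (SigmaI Ω P T k) :=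
    Submodule.finiteDimensional_of_le (S₂ := piecewisePoly Ω P T (k + 1) 2) fun ψ hψ => hψ.1.2
  have hH1 (ψ : SigmaI Ω P T k) : curl ψ.1 ∈ (H1 Ω).prod (H1 Ω) := curl_mem ψ.2.1.1.1
  let curlI : SigmaI Ω P T k →ₗ[ℝ] (H1 Ω).prod (H1 Ω) :=
    { toFun := fun ψ => ⟨curl ψ.1, hH1 ψ⟩
      map_add' := fun φ ψ => Subtype.ext (curl_add φ.2.1.1.1.1 ψ.2.1.1.1.1)
      map_smul' := fun c ψ => Subtype.ext (curl_smul c ψ.2.1.1.1.1) }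
  obtain ⟨ψ, hψ⟩ := exists_forall_inner_map_eq (grad ∘ₗ curlI) (grad ⟨v, hv⟩)
  refine ⟨ψ, ψ.2, fun χ hχ => ?_⟩
  rw [a_sub_left hv (hH1 ψ), sub_eq_zero]
  exact (inner_grad ⟨v, hv⟩ (curlI ⟨χ, hχ⟩)).symm.trans
    ((hψ ⟨χ, hχ⟩).symm.trans (inner_grad (curlI ψ) (curlI ⟨χ, hχ⟩)))

end Energy

section Decompositions

variable {n : ℕ} {Ω : Opens Pt} {P : Polygon Pt n} {T : Finset Tri} {k : ℕ}

theorem isDirectSum_of_forall_exists {E : Type*} [AddCommGroup E] [Module ℝ E]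
    {A B C : Submodule ℝ E} (hBA : B ≤ A) (hCA : C ≤ A) (hsum : ∀ x ∈ A, ∃ y ∈ B, x - y ∈ C)
    (hinter : ∀ x ∈ B, x ∈ C → x = 0) : IsDirectSum A B C := by
  refine ⟨le_antisymm (fun x hx => ?_) (sup_le hBA hCA),
    (Submodule.eq_bot_iff _).2 fun x hx => hinter x hx.1 hx.2⟩
  obtain ⟨y, hy, hxy⟩ := hsum x hx
  exact Submodule.mem_sup.2 ⟨y, hy, x - y, hxy, add_sub_cancel y x⟩

theorem IsMesh.isDirectSum_Sigma0 (hT : IsMesh Ω T) :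
    IsDirectSum (Sigma0 Ω P T k) (SigmaI Ω P T k) (SigmaE Ω P T k) := by
  refine isDirectSum_of_forall_exists (fun _ h => h.1) (fun _ h => h.1) (fun φ hφ => ?_)
    fun ψ hψ hψE => hT.eq_zero_of_a_curl_self hψ (hψE.2 ψ hψ)
  obtain ⟨ψ, hψ, horth⟩ := hT.exists_curl_projection (curl_mem hφ.1.1)
  refine ⟨ψ, hψ, sub_mem hφ hψ.1, fun χ hχ => ?_⟩
  rw [curl_sub hφ.1.1.1 hψ.1.1.1.1, horth χ hχ]

theorem IsMesh.exists_sub_mem_QE (hT : IsMesh Ω T) {q : L2 Ω} (hq : q ∈ Q0 Ω P T k) :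
    ∃ r ∈ QI Ω P T k, q - r ∈ QE Ω P T k := by
  have : FiniteDimensional ℝ (Q Ω P T k) := hT.finiteDimensional_piecewisePoly _ _
  have : FiniteDimensional ℝ (QI Ω P T k) :=
    Submodule.finiteDimensional_of_le (S₂ := Q Ω P T k) fun q hq => hq.1.1
  obtain ⟨r, hr, z, hz, rfl⟩ := (QI Ω P T k).exists_add_mem_mem_orthogonal q
  refine ⟨r, hr, sub_mem hq hr.1, fun s hs => ?_⟩
  rw [add_sub_cancel_left]
  exact Submodule.inner_left_of_mem_orthogonal hs hz

theorem IsMesh.isDirectSum_Q0 (hT : IsMesh Ω T) :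
    IsDirectSum (Q0 Ω P T k) (QI Ω P T k) (QE Ω P T k) :=
  isDirectSum_of_forall_exists (fun _ h => h.1) (fun _ h => h.1)
    (fun _ hq => hT.exists_sub_mem_QE hq) fun q hqI hqE => inner_self_eq_zero.1 (hqE.2 q hqI)

theorem IsMesh.exists_sub_mem_VE (hT : IsMesh Ω T) (hk : 1 ≤ k) {v : L2 Ω × L2 Ω}
    (hv : v ∈ V0 Ω P T k) : ∃ w ∈ VI Ω P T k, v - w ∈ VE Ω P T k := by
  obtain ⟨r, hr, hrE⟩ := hT.exists_sub_mem_QE (hT.div_mem_Q0 hv)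
  obtain ⟨w, hw, rfl⟩ := hT.exists_div_eq hk hr
  have hvw : v - w ∈ V0 Ω P T k := sub_mem hv hw.1
  obtain ⟨ψ, hψ, horth⟩ := hT.exists_curl_projection (k := k) (V0_le Ω P T k hvw)
  have hcurl := hT.curl_mem_VI hψ
  refine ⟨w + curl ψ, add_mem hw hcurl, ?_⟩
  rw [← sub_sub]
  refine ⟨sub_mem hvw hcurl.1, ?_, horth⟩
  rwa [div_sub (V0_le Ω P T k hvw) (V0_le Ω P T k hcurl.1), hT.div_curl hψ, sub_zero,
    div_sub (V0_le Ω P T k hv) (V0_le Ω P T k hw.1)]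

theorem IsMesh.isDirectSum_V0 (hT : IsMesh Ω T) (hk : 1 ≤ k) :
    IsDirectSum (V0 Ω P T k) (VI Ω P T k) (VE Ω P T k) := by
  refine isDirectSum_of_forall_exists (fun _ h => h.1) (fun _ h => h.1)
    (fun _ hv => hT.exists_sub_mem_VE hk hv) fun v hv hvE => ?_
  have hdiv : div v = 0 := inner_self_eq_zero.1 (hvE.2.1.2 _ (hT.div_mem_QI hv))
  obtain ⟨ψ, hψ, rfl⟩ := hT.exists_curl_eq hv hdiv
  exact hT.eq_zero_of_a_self hv (hvE.2.2 ψ hψ)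

end Decompositions

end StokesFE

end

theorem mainTheorem7_general {n : ℕ} (Ω : Opens StokesFE.Pt) (P : Polygon StokesFE.Pt n)
    (T : Finset StokesFE.Tri) (hT : StokesFE.IsMesh Ω T) (k : ℕ) (hk : 1 ≤ k) :
    StokesFE.IsDirectSum (StokesFE.Sigma0 Ω P T k) (StokesFE.SigmaI Ω P T k)
      (StokesFE.SigmaE Ω P T k) ∧
    StokesFE.IsDirectSum (StokesFE.V0 Ω P T k) (StokesFE.VI Ω P T k)
      (StokesFE.VE Ω P T k) ∧
    StokesFE.IsDirectSum (StokesFE.Q0 Ω P T k) (StokesFE.QI Ω P T k)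
      (StokesFE.QE Ω P T k) :=
  ⟨hT.isDirectSum_Sigma0, hT.isDirectSum_V0 hk, hT.isDirectSum_Q0⟩

theorem mainTheorem7 {n : ℕ} [NeZero n] (Ω : TopologicalSpace.Opens StokesFE.Pt)
    (P : Polygon StokesFE.Pt n) (hΩ : StokesFE.IsPolygonalDomain Ω P)
    (T : Finset StokesFE.Tri) (hT : StokesFE.IsMesh Ω T) (k : ℕ) (hk : 1 ≤ k) :
    StokesFE.IsDirectSum (StokesFE.Sigma0 Ω P T k) (StokesFE.SigmaI Ω P T k)
      (StokesFE.SigmaE Ω P T k) ∧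
    StokesFE.IsDirectSum (StokesFE.V0 Ω P T k) (StokesFE.VI Ω P T k)
      (StokesFE.VE Ω P T k) ∧
    StokesFE.IsDirectSum (StokesFE.Q0 Ω P T k) (StokesFE.QI Ω P T k)
      (StokesFE.QE Ω P T k) :=
  mainTheorem7_general Ω P T hT k hk
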